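/- Let $p$ be a prime and $\lambda_p = 2-\frac1p$. Define subgroups $B_n^{(p)}$ of the symmetric group $S_{p^n}$ recursively: $B_0^{(p)}$ is trivial and, for $n\ge 0$, dividing $\{1,\dots,p^{n+1}\}$ into $p$ consecutive blocks of length $p^n$, $B_{n+1}^{(p)}$ is the (internal semidirect) product of the group $\bigoplus_{j=1}^p B_n^{(p)}$ of all block sums $\sigma_1\oplus\cdots\oplus\sigma_p$ with $\sigma_j\in B_n^{(p)}$ ($\sigma_j$ acting inside the $j$-th block) and the cyclic group generated by the permutation that moves each block cyclically onto the next one and keeps the positions inside the blocks. Let $C(\sigma)$ be the number of cycles of a permutation $\sigma$, fixed points included. Then: 1. For every $n\ge0$, $B_n^{(p)}$ is a $p$-Sylow subgroup of $S_{p^n}$. 2. Define $m_0^{(p)}=m_1^{(p)}=1$ and, for $k\ge 2$, $$m_k^{(p)} = \frac1{p-1}\cdot\frac{\lambda_p-1}{\lambda_p^k-\lambda_p}\sum_{\substack{i_1+\cdots+i_p=k\\ 0\le i_1,\dots,i_p<k}}\binom{k}{i_1,\dots,i_p}\prod_{\ell=1}^p m_{i_\ell}^{(p)} .$$ There is a unique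 probability law $W^{(p)}$ on $(0,\infty)$ all of whose moments are finite and equal to these numbers, that is, $\mathbb E[(W^{(p)})^k]=m_k^{(p)}$ for all integers $k\ge 0$. It has full support: every nonempty open subset of $(0,\infty)$ has positive probability. 3. If $\sigma_n$ is uniformly distributed on $B_n^{(p)}$, then $C(\sigma_n)\,\lambda_p^{-n}$ converges in distribution to $W^{(p)}$ as $n\to\infty$. 4. More generally, if for each $n$ the permutation $\sigma_n$ is uniformly distributed on an arbitrary $p$-Sylow subgroup $P_n$ of $S_{p^n}$, then $C(\sigma_n)\,\lambda_p^{-n}$ converges in distribution to the same law $W^{(p)}$. -/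

import Mathlib

open Filter Topology MeasureTheory

/-- The identification of `Fin (m ^ (n + 1))` with `m` consecutive blocks of length `m ^ n`:
the pair `(j, i)` is position `i` in the `j`-th block, that is, the number `j * m ^ n + i`. -/
def blockEquiv (m n : ℕ) : Fin m × Fin (m ^ n) ≃ Fin (m ^ (n + 1)) :=
  finProdFinEquiv.trans (finCongr (pow_succ' m n).symm)

theorem blockEquiv_val (m n : ℕ) (x : Fin m × Fin (m ^ n)) :
    (blockEquiv m n x : ℕ) = x.1 * m ^ n + x.2 := by
  simp [blockEquiv, Nat.mul_comm, Nat.add_comm]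

/-- The block sum `σ 0 ⊕ ⋯ ⊕ σ (m - 1)`: the `j`-th permutation acts inside the `j`-th block. -/
def blockSum (m n : ℕ) :
    (Fin m → Equiv.Perm (Fin (m ^ n))) →* Equiv.Perm (Fin (m ^ (n + 1))) where
  toFun σ := (blockEquiv m n).permCongr (Equiv.prodCongrRight σ)
  map_one' := by
    ext x
    simp [Equiv.permCongr_apply, Equiv.prodCongrRight]
  map_mul' σ τ := by
    ext x
    simp [Equiv.permCongr_apply, Equiv.prodCongrRight]

/-- The permutation `τ ⊗ 1` with `τ` the standard `m`-cycle `j ↦ j + 1`: it moves the `j`-th block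
onto the next one (cyclically) and keeps the position inside the block. -/
def blockShift (m n : ℕ) : Equiv.Perm (Fin (m ^ (n + 1))) :=
  (blockEquiv m n).permCongr (Equiv.prodCongr (finRotate m) (Equiv.refl _))

/-- The nonsimple `m`-nary butterfly permutations of length `m ^ n`. The group is trivial for
`n = 0`, and at stage `n + 1` it is the (internal semidirect) product, inside the symmetric group,
of the `m`-fold block sum of the group at stage `n` and the cyclic group generated by `τ ⊗ 1`. -/
def butterflyGroup (m : ℕ) : (n : ℕ) → Subgroup (Equiv.Perm (Fin (m ^ n)))
  | 0 => ⊥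
  | n + 1 =>
      (Subgroup.pi Set.univ (fun _ : Fin m => butterflyGroup m n)).map (blockSum m n) ⊔
        Subgroup.zpowers (blockShift m n)

/-- The number of cycles of a permutation, fixed points included: the number of its orbits. -/
noncomputable def numCycles {α : Type*} (σ : Equiv.Perm α) : ℕ :=
  Nat.card (Quotient (Equiv.Perm.SameCycle.setoid σ))

/-- The law on `ℝ` of `C(σ) * (2 - 1 / p) ^ (-n)`, where `σ` is uniformly distributed on the
subgroup `H` of the symmetric group of degree `p ^ n` and `C(σ)` is its number of cycles. -/
noncomputable def scaledCycleLaw (p n : ℕ) (H : Subgroup (Equiv.Perm (Fin (p ^ n)))) :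
    ProbabilityMeasure ℝ :=
  letI : Fintype H := Fintype.ofFinite H
  ⟨((PMF.uniformOfFintype H).map
      (fun σ => (numCycles (σ : Equiv.Perm (Fin (p ^ n))) : ℝ) / (2 - 1 / (p : ℝ)) ^ n)).toMeasure,
    inferInstance⟩

/-! The cycle counts form a Galton–Watson process. A uniform element of `butterflyGroup p (n + 1)`
is a uniform power of the block shift times a block sum of `p` independent uniform elements of rank
`n`. If the power is trivial (probability `1/p`), the `p` cycle counts add. Otherwise the shift
permutes the blocks in one `p`-cycle, and the cycles correspond to those of the product of the block
entries along that cycle, which is again uniform of rank `n`. Hence the generating function of the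
cycle count is the `n`-th iterate of `f(z) = (1 - 1/p) z + z^p / p`, with `f'(1) = λ = 2 - 1/p`
(`cyclePGF_butterflyGroup`). Sylow subgroups are conjugate and conjugation preserves cycle counts,
so the same holds for all of them.

The characteristic functions `f^[n] (exp (i t / λ^n))` converge geometrically fast to some `φ` with
`φ(t) = exp (i t) + O(t²)`, and Lévy's theorem gives a limit law `W` of mean `1`. The equation `φ(λ
t) = f(φ(t))` says that `λ W` is distributed as `W` with probability `1 - 1/p` and as a sum of `p`
independent copies of `W` with probability `1/p` (`eq_mixture`). This yields the moment recursion,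
the absence of an atom at `0` and the support. Bounds on the real iterates `f^[n] (exp (s / λ^n))`
give `W` all exponential moments, so its moments determine it. -/

/-! ### Cycle counts of permutations of a product -/

theorem numCycles_permCongr {α β : Type*} (e : α ≃ β) (σ : Equiv.Perm α) :
    numCycles (e.permCongr σ) = numCycles σ := by
  refine (Nat.card_congr (Quotient.congr e fun x y => ?_)).symm
  have h : ∀ k : ℤ, (e.permCongr σ) ^ k = e.permCongr (σ ^ k) := fun k =>
    (map_zpow e.permCongrHom σ k).symm
  change σ.SameCycle x y ↔ (e.permCongr σ).SameCycle (e x) (e y)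
  simp [Equiv.Perm.SameCycle, h, Equiv.permCongr_apply]

theorem numCycles_one (α : Type*) : numCycles (1 : Equiv.Perm α) = Nat.card α := by
  refine (Nat.card_congr (Equiv.ofBijective (Quotient.mk _) ⟨fun x y h => ?_, Quot.mk_surjective⟩)).symm
  obtain ⟨k, hk⟩ := (Quotient.exact h : (1 : Equiv.Perm α).SameCycle x y)
  simpa using hk

/-- The permutation `(j, x) ↦ (ρ j, σ j x)` of `ι × α`. -/
def skewPerm {ι α : Type*} (ρ : Equiv.Perm ι) (σ : ι → Equiv.Perm α) : Equiv.Perm (ι × α) :=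
  (Equiv.prodCongrRight σ).trans (Equiv.prodCongr ρ (Equiv.refl _))

@[simp] theorem skewPerm_apply {ι α : Type*} (ρ : Equiv.Perm ι) (σ : ι → Equiv.Perm α)
    (x : ι × α) : skewPerm ρ σ x = (ρ x.1, σ x.1 x.2) := rfl

theorem skewPerm_mul {ι α : Type*} (ρ ρ' : Equiv.Perm ι) (σ σ' : ι → Equiv.Perm α) :
    skewPerm ρ σ * skewPerm ρ' σ' = skewPerm (ρ * ρ') (fun j => σ (ρ' j) * σ' j) := by
  ext x <;> simp

theorem skewPerm_one_zpow {ι α : Type*} (σ : ι → Equiv.Perm α) (k : ℤ) (x : ι × α) :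
    (skewPerm 1 σ ^ k) x = (x.1, (σ x.1 ^ k) x.2) := by
  let φ : (ι → Equiv.Perm α) →* Equiv.Perm (ι × α) :=
    { toFun := skewPerm 1
      map_one' := by ext x <;> simp
      map_mul' := fun σ τ => by ext x <;> simp }
  change ((φ σ) ^ k) x = _
  rw [← map_zpow]
  rfl

theorem numCycles_skewPerm_one {ι α : Type*} [Fintype ι] [Finite α] (σ : ι → Equiv.Perm α) :
    numCycles (skewPerm 1 σ) = ∑ j, numCycles (σ j) := by
  have key : ∀ x y : ι × α, (skewPerm 1 σ).SameCycle x y ↔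
      x.1 = y.1 ∧ (σ x.1).SameCycle x.2 y.2 := by
    intro x y
    simp only [Equiv.Perm.SameCycle, skewPerm_one_zpow, Prod.ext_iff, exists_and_left]
  unfold numCycles
  rw [← Nat.card_sigma]
  refine Nat.card_congr (Equiv.ofBijective
    (Quotient.lift (fun x : ι × α => (⟨x.1, Quotient.mk _ x.2⟩ :
      Σ j, Quotient (Equiv.Perm.SameCycle.setoid (σ j)))) ?_) ⟨?_, ?_⟩)
  · rintro ⟨i, x⟩ ⟨j, y⟩ h
    obtain ⟨h1, h2⟩ := (key _ _).1 h
    obtain rfl : i = j := h1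
    exact Sigma.ext rfl (heq_of_eq (Quotient.sound h2))
  · rintro ⟨i, x⟩ ⟨j, y⟩ h
    obtain ⟨h1, h2⟩ := Sigma.mk.inj h
    obtain rfl : i = j := h1
    exact Quotient.sound ((key _ _).2 ⟨rfl, Quotient.exact (eq_of_heq h2)⟩)
  · rintro ⟨i, q⟩
    induction q using Quotient.inductionOn with
    | h x => exact ⟨Quotient.mk _ (i, x), rfl⟩

/-- The product of the permutations met in the first `k` steps along the `ρ`-orbit of `i`. -/
def orbitProd {ι G : Type*} [Group G] (ρ : Equiv.Perm ι) (i : ι) (σ : ι → G) : ℕ → G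
  | 0 => 1
  | k + 1 => σ ((ρ ^ k) i) * orbitProd ρ i σ k

theorem map_orbitProd {ι G G' : Type*} [Group G] [Group G'] (f : G →* G') (ρ : Equiv.Perm ι) (i : ι)
    (σ : ι → G) (k : ℕ) : f (orbitProd ρ i σ k) = orbitProd ρ i (fun j => f (σ j)) k := by
  induction k with
  | zero => simp [orbitProd]
  | succ k ih => simp [orbitProd, ih]

theorem skewPerm_pow_apply {ι α : Type*} (ρ : Equiv.Perm ι) (σ : ι → Equiv.Perm α) (i : ι) (x : α)
    (k : ℕ) : (skewPerm ρ σ ^ k) (i, x) = ((ρ ^ k) i, orbitProd ρ i σ k x) := by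
  induction k with
  | zero => simp [orbitProd]
  | succ k ih => rw [pow_succ', Equiv.Perm.mul_apply, ih]; simp [orbitProd, pow_succ']

/-- Every cycle meets the fibre over `i`, and the first return map to that fibre is `orbitProd ρ i σ
p`. Cycles of a permutation correspond to cycles of its return map. -/
theorem numCycles_skewPerm_of_transitive {ι α : Type*} [Finite ι] [Finite α]
    (ρ : Equiv.Perm ι) (σ : ι → Equiv.Perm α) (i : ι) (p : ℕ)
    (htrans : ∀ j, ∃ k : ℕ, (ρ ^ k) i = j) (hper : ∀ k : ℕ, (ρ ^ k) i = i ↔ p ∣ k) :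
    numCycles (skewPerm ρ σ) = numCycles (orbitProd ρ i σ p) := by
  set π := skewPerm ρ σ
  set τ := orbitProd ρ i σ p
  have hp : (ρ ^ p) i = i := (hper p).2 dvd_rfl
  have hpow : ∀ (m : ℕ) (x : α), (π ^ (p * m)) (i, x) = (i, (τ ^ m) x) := by
    intro m
    induction m with
    | zero => simp
    | succ m ih =>
      intro x
      rw [Nat.mul_succ, pow_add, Equiv.Perm.mul_apply, skewPerm_pow_apply ρ σ i x p, hp, ih,
        pow_succ]
      rfl
  have key : ∀ x y : α, τ.SameCycle x y ↔ π.SameCycle (i, x) (i, y) := by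
    intro x y
    constructor
    · intro h
      obtain ⟨m, hm⟩ := h.exists_nat_pow_eq
      exact ⟨((p * m : ℕ) : ℤ), by rw [zpow_natCast, hpow, hm]⟩
    · intro h
      obtain ⟨k, hk⟩ := h.exists_nat_pow_eq
      have h1 : (ρ ^ k) i = i := by
        rw [skewPerm_pow_apply] at hk
        exact (Prod.ext_iff.1 hk).1
      obtain ⟨m, rfl⟩ := (hper k).1 h1
      rw [hpow] at hk
      exact ⟨(m : ℤ), by rw [zpow_natCast]; exact (Prod.ext_iff.1 hk).2⟩
  refine (Nat.card_congr (Equiv.ofBijective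
    (Quotient.map (fun x : α => (i, x)) fun x y h => (key x y).1 h) ⟨?_, ?_⟩)).symm
  · intro a b
    induction a using Quotient.inductionOn with
    | h x =>
      induction b using Quotient.inductionOn with
      | h y => exact fun h => Quotient.sound ((key x y).2 (Quotient.exact h))
  · intro q
    induction q using Quotient.inductionOn with
    | h z =>
      obtain ⟨j, y⟩ := z
      obtain ⟨k, hk⟩ := htrans j
      -- The point of the fibre over `i` that reaches `(j, y)` after `k` steps.
      refine ⟨Quotient.mk _ ((orbitProd ρ i σ k)⁻¹ y), Quotient.sound ?_⟩
      refine (⟨(k : ℤ), ?_⟩ : π.SameCycle _ _)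
      rw [zpow_natCast, skewPerm_pow_apply, hk]
      simp

/-- During the first `p` steps the orbit is at `i` only at time `0`, and `σ i` is the rightmost
factor. -/
theorem orbitProd_mul_mulSingle {ι G : Type*} [DecidableEq ι] [Group G] (ρ : Equiv.Perm ι) (i : ι)
    (p : ℕ) (hper : ∀ k : ℕ, (ρ ^ k) i = i ↔ p ∣ k) (σ : ι → G) (g : G) (k : ℕ) (hk : k < p) :
    orbitProd ρ i (σ * Pi.mulSingle i g) (k + 1) = orbitProd ρ i σ (k + 1) * g := by
  induction k with
  | zero => simp [orbitProd]
  | succ k ih =>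
    have h : (ρ ^ (k + 1)) i ≠ i := fun h => absurd (Nat.le_of_dvd (by omega) ((hper _).1 h)) (by omega)
    rw [orbitProd, ih (by omega), orbitProd.eq_2 ρ i σ (k + 1), Pi.mul_apply,
      Pi.mulSingle_eq_of_ne h, mul_one, mul_assoc]

/-- The product of independent uniform elements along a full orbit is uniform. -/
theorem sum_orbitProd {ι G M : Type*} [Fintype ι] [DecidableEq ι] [Group G] [Fintype G]
    [AddCommMonoid M] (ρ : Equiv.Perm ι) (i : ι) (p : ℕ) (hp : 0 < p)
    (hper : ∀ k : ℕ, (ρ ^ k) i = i ↔ p ∣ k) (F : G → M) :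
    Fintype.card G • ∑ σ : ι → G, F (orbitProd ρ i σ p) =
      Fintype.card G ^ Fintype.card ι • ∑ g, F g := by
  obtain ⟨q, rfl⟩ : ∃ q, p = q + 1 := ⟨p - 1, by omega⟩
  -- Average over the bijections `σ ↦ σ * Pi.mulSingle i g`, which multiply the orbit product by `g`
  -- on the right. The factor `Fintype.card G` replaces a division.
  calc Fintype.card G • ∑ σ : ι → G, F (orbitProd ρ i σ (q + 1))
      = ∑ g : G, ∑ σ : ι → G, F (orbitProd ρ i (σ * Pi.mulSingle i g) (q + 1)) := by
        rw [← Finset.card_univ, ← Finset.sum_const]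
        exact Finset.sum_congr rfl fun g _ =>
          (Equiv.sum_comp (Equiv.mulRight (Pi.mulSingle i g : ι → G))
            fun σ => F (orbitProd ρ i σ (q + 1))).symm
    _ = ∑ σ : ι → G, ∑ g : G, F (orbitProd ρ i σ (q + 1) * g) := by
        rw [Finset.sum_comm]
        simp only [orbitProd_mul_mulSingle ρ i _ hper _ _ q (Nat.lt_succ_self q)]
    _ = ∑ σ : ι → G, ∑ g : G, F g :=
        Finset.sum_congr rfl fun σ _ =>
          Equiv.sum_comp (Equiv.mulLeft (orbitProd ρ i σ (q + 1))) F
    _ = _ := by simp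

/-! ### The rotation of `Fin p` -/

theorem finRotate_pow_apply (p : ℕ) [NeZero p] (k : ℕ) (i : Fin p) :
    (finRotate p ^ k) i = i + Fin.ofNat p k := by
  obtain ⟨q, rfl⟩ : ∃ q, p = q + 1 := ⟨p - 1, (Nat.succ_pred (NeZero.ne p)).symm⟩
  induction k with
  | zero => simp
  | succ k ih =>
    rw [pow_succ', Equiv.Perm.mul_apply, ih, finRotate_apply]
    ext
    simp [Fin.val_add, add_assoc]

theorem finRotate_pow_apply_zero (p : ℕ) [NeZero p] (k : ℕ) :
    ((finRotate p ^ k) 0 : Fin p) = Fin.ofNat p k := by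
  rw [finRotate_pow_apply, zero_add]

theorem finRotate_pow_card (p : ℕ) [NeZero p] : finRotate p ^ p = 1 := by
  ext i
  simp [finRotate_pow_apply]

/-- For `p` prime, `p ∣ a * k` forces `p ∣ k`: every nontrivial power of the rotation is again a
single `p`-cycle. -/
theorem finRotate_pow_pow_apply_zero_eq_zero_iff (p : ℕ) [hp : Fact p.Prime] (a : ℕ) (ha : ¬ p ∣ a)
    (k : ℕ) : ((finRotate p ^ a) ^ k) 0 = 0 ↔ p ∣ k := by
  rw [← pow_mul, finRotate_pow_apply_zero, Fin.ext_iff]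
  simp [← Nat.dvd_iff_mod_eq_zero, hp.out.dvd_mul, ha]

theorem exists_finRotate_pow_pow_apply_zero (p : ℕ) [hp : Fact p.Prime] (a : ℕ) (ha : ¬ p ∣ a)
    (j : Fin p) : ∃ k : ℕ, ((finRotate p ^ a) ^ k) 0 = j := by
  have hc : Nat.Coprime a p := ((Nat.Prime.coprime_iff_not_dvd hp.out).2 ha).symm
  obtain ⟨b, -, hb⟩ := Nat.exists_mul_mod_eq_one_of_coprime hc hp.out.one_lt
  refine ⟨b * j, ?_⟩
  rw [← pow_mul, finRotate_pow_apply_zero, Fin.ext_iff]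
  simp only [Fin.ofNat_eq_cast, Fin.val_natCast]
  rw [← mul_assoc, Nat.mul_mod, hb, one_mul, Nat.mod_mod, Nat.mod_eq_of_lt j.2]

/-! ### Structure of the butterfly groups -/

theorem zpow_eq_pow_toNat_emod {G : Type*} [Group G] {x : G} {p : ℕ} (hp : 0 < p) (hx : x ^ p = 1)
    (a : ℤ) : x ^ a = x ^ (a % p).toNat := by
  have h : ((a % p).toNat : ℤ) = a % p := Int.toNat_of_nonneg (Int.emod_nonneg _ (by omega))
  rw [← zpow_natCast, h]
  conv_lhs => rw [← Int.emod_add_mul_ediv a p, zpow_add, zpow_mul, zpow_natCast, hx, one_zpow, mul_one]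

theorem blockSum_eq (m n : ℕ) (σ : Fin m → Equiv.Perm (Fin (m ^ n))) :
    blockSum m n σ = (blockEquiv m n).permCongr (skewPerm 1 σ) := rfl

theorem blockShift_zpow (m n : ℕ) (a : ℤ) :
    blockShift m n ^ a = (blockEquiv m n).permCongr (skewPerm (finRotate m ^ a) 1) := by
  let φ : Equiv.Perm (Fin m) →* Equiv.Perm (Fin (m ^ (n + 1))) :=
    (blockEquiv m n).permCongrHom.toMonoidHom.comp
      { toFun := fun ρ => skewPerm ρ 1
        map_one' := by ext x <;> simp
        map_mul' := fun σ τ => by ext x <;> simp }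
  exact (map_zpow φ (finRotate m) a).symm

theorem blockShift_zpow_mul_blockSum (m n : ℕ) (a : ℤ) (σ : Fin m → Equiv.Perm (Fin (m ^ n))) :
    blockShift m n ^ a * blockSum m n σ =
      (blockEquiv m n).permCongr (skewPerm (finRotate m ^ a) σ) := by
  rw [blockShift_zpow, blockSum_eq]
  refine (map_mul (blockEquiv m n).permCongrHom _ _).symm.trans ?_
  rw [skewPerm_mul, mul_one]
  rfl

theorem mem_butterflyGroup_succ (p n : ℕ) [NeZero p] (τ : Equiv.Perm (Fin (p ^ (n + 1)))) :
    τ ∈ butterflyGroup p (n + 1) ↔ ∃ (a : Fin p) (σ : Fin p → butterflyGroup p n),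
      (blockEquiv p n).permCongr (skewPerm (finRotate p ^ (a : ℕ)) fun j => (σ j).1) = τ := by
  have hp : 0 < p := Nat.pos_of_ne_zero (NeZero.ne p)
  constructor
  · intro h
    -- The skew permutations over powers of the rotation, with entries in the group of rank `n`,
    -- already form a group, so the join cannot be larger than its image.
    let K : Subgroup (Equiv.Perm (Fin p × Fin (p ^ n))) :=
      { carrier := {π | ∃ (a : ℤ) (σ : Fin p → butterflyGroup p n),
          skewPerm (finRotate p ^ a) (fun j => (σ j).1) = π}
        one_mem' := ⟨0, 1, by ext x <;> simp⟩
        mul_mem' := by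
          rintro _ _ ⟨a, σ, rfl⟩ ⟨b, τ, rfl⟩
          exact ⟨a + b, fun j => σ ((finRotate p ^ b) j) * τ j, by rw [skewPerm_mul, zpow_add]; rfl⟩
        inv_mem' := by
          rintro _ ⟨a, σ, rfl⟩
          refine ⟨-a, fun j => (σ ((finRotate p ^ (-a)) j))⁻¹, eq_inv_of_mul_eq_one_left ?_⟩
          rw [skewPerm_mul]
          ext x <;> simp }
    have hle : butterflyGroup p (n + 1) ≤ K.map (blockEquiv p n).permCongrHom.toMonoidHom := by
      refine sup_le ?_ ?_
      · rintro _ ⟨σ, hσ, rfl⟩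
        exact ⟨skewPerm 1 σ, ⟨0, fun j => ⟨σ j, hσ j trivial⟩, by simp⟩, rfl⟩
      · rw [Subgroup.zpowers_le]
        exact ⟨skewPerm (finRotate p) 1, ⟨1, 1, by rw [zpow_one]; rfl⟩, rfl⟩
    obtain ⟨_, ⟨a, σ, rfl⟩, rfl⟩ := hle h
    have ha : (a % p).toNat < p := by
      have := Int.emod_lt_of_pos a (by exact_mod_cast hp : (0 : ℤ) < p)
      omega
    refine ⟨⟨(a % p).toNat, ha⟩, σ, ?_⟩
    rw [← zpow_eq_pow_toNat_emod hp (finRotate_pow_card p)]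
    rfl
  · rintro ⟨a, σ, rfl⟩
    rw [← zpow_natCast, ← blockShift_zpow_mul_blockSum]
    refine mul_mem ?_ ?_
    · exact Subgroup.mem_sup_right (Subgroup.zpow_mem _ (Subgroup.mem_zpowers _) _)
    · exact Subgroup.mem_sup_left ⟨_, fun j _ => (σ j).2, rfl⟩

/-- An element of the butterfly group of rank `n + 1` is uniquely a product of a power of the
block shift and a block sum. -/
noncomputable def butterflyEquiv (p n : ℕ) [NeZero p] :
    Fin p × (Fin p → butterflyGroup p n) ≃ butterflyGroup p (n + 1) :=
  Equiv.ofBijective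
    (fun x => ⟨(blockEquiv p n).permCongr (skewPerm (finRotate p ^ (x.1 : ℕ)) fun j => (x.2 j).1),
      (mem_butterflyGroup_succ p n _).2 ⟨x.1, x.2, rfl⟩⟩) <| by
    constructor
    · rintro ⟨a, σ⟩ ⟨b, τ⟩ h
      have h1 := (blockEquiv p n).permCongr.injective (Subtype.ext_iff.1 h)
      have h2 : ∀ j x, ((finRotate p ^ (a : ℕ)) j, (σ j).1 x) =
        ((finRotate p ^ (b : ℕ)) j, (τ j).1 x) := fun j x => Equiv.ext_iff.1 h1 (j, x)
      -- The image of position `0` of block `0` reveals the exponent of the shift.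
      have h3 := (Prod.ext_iff.1 (h2 0 ⟨0, pow_pos (Nat.pos_of_ne_zero (NeZero.ne p)) n⟩)).1
      simp only [finRotate_pow_apply_zero] at h3
      refine Prod.ext ?_ (funext fun j => Subtype.ext (Equiv.ext fun x => (Prod.ext_iff.1 (h2 j x)).2))
      simpa using h3
    · rintro ⟨τ, hτ⟩
      obtain ⟨a, σ, h⟩ := (mem_butterflyGroup_succ p n τ).1 hτ
      exact ⟨(a, σ), Subtype.ext h⟩

theorem butterflyEquiv_coe (p n : ℕ) [NeZero p] (x : Fin p × (Fin p → butterflyGroup p n)) :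
    (butterflyEquiv p n x : Equiv.Perm (Fin (p ^ (n + 1)))) =
      (blockEquiv p n).permCongr (skewPerm (finRotate p ^ (x.1 : ℕ)) fun j => (x.2 j).1) := rfl

theorem card_butterflyGroup_succ (p n : ℕ) [NeZero p] :
    Nat.card (butterflyGroup p (n + 1)) = p * Nat.card (butterflyGroup p n) ^ p := by
  rw [← Nat.card_congr (butterflyEquiv p n), Nat.card_prod, Nat.card_fun]
  simp

theorem card_butterflyGroup (p n : ℕ) [hp : Fact p.Prime] :
    Nat.card (butterflyGroup p n) = p ^ padicValNat p (p ^ n).factorial := by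
  have key : ∀ n, padicValNat p (p ^ (n + 1)).factorial =
      p ^ n + padicValNat p (p ^ n).factorial := fun n => by
    rw [pow_succ', padicValNat_factorial_mul, add_comm]
  -- Legendre's value `(p^n - 1) / (p - 1)`, written without division or subtraction.
  have hrec : ∀ n, p * padicValNat p (p ^ n).factorial + 1 =
      p ^ n + padicValNat p (p ^ n).factorial := by
    intro n
    induction n with
    | zero => simp
    | succ n ih => rw [key, mul_add, add_assoc, ih, pow_succ']
  induction n with
  | zero =>
    change Nat.card (⊥ : Subgroup _) = _
    rw [Subgroup.card_bot]
    simp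
  | succ n ih =>
    rw [card_butterflyGroup_succ, ih, key, ← hrec, pow_succ', ← pow_mul, mul_comm p (padicValNat _ _)]

/-- The butterfly group as a Sylow subgroup of the symmetric group. -/
noncomputable def butterflySylow (p n : ℕ) [Fact p.Prime] : Sylow p (Equiv.Perm (Fin (p ^ n))) :=
  Sylow.ofCard (butterflyGroup p n) <| by
    rw [card_butterflyGroup, Nat.card_perm, Nat.card_fin, Nat.factorization_def _ Fact.out]

theorem coe_butterflySylow (p n : ℕ) [Fact p.Prime] :
    (butterflySylow p n : Subgroup (Equiv.Perm (Fin (p ^ n)))) = butterflyGroup p n :=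
  Sylow.coe_ofCard _ _

/-! ### The generating polynomial of the number of cycles -/

/-- The probability generating function, at `z`, of the number of cycles of a uniform element. -/
noncomputable def cyclePGF {K α : Type*} [Field K] [Finite α] (H : Subgroup (Equiv.Perm α)) (z : K) : K :=
  letI : Fintype H := Fintype.ofFinite H
  (Nat.card H : K)⁻¹ * ∑ σ : H, z ^ numCycles (σ : Equiv.Perm α)

theorem cyclePGF_eq {K α : Type*} [Field K] [Finite α] (H : Subgroup (Equiv.Perm α)) [Fintype H] (z : K) :
    cyclePGF H z = (Nat.card H : K)⁻¹ * ∑ σ : H, z ^ numCycles (σ : Equiv.Perm α) := by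
  rw [cyclePGF]
  congr!

/-- The offspring generating function: one child with probability `1 - 1 / p`, and `p` children
with probability `1 / p`. -/
def offspringPGF {K : Type*} [Field K] (p : ℕ) (z : K) : K := (1 - 1 / (p : K)) * z + 1 / (p : K) * z ^ p

theorem cyclePGF_butterflyGroup_zero {K : Type*} [Field K] [CharZero K] (p : ℕ) (z : K) : cyclePGF (butterflyGroup p 0) z = z := by
  have h : ∀ σ : butterflyGroup p 0, numCycles (σ : Equiv.Perm (Fin (p ^ 0))) = 1 := by
    rintro ⟨σ, hσ⟩
    obtain rfl : σ = 1 := hσ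
    rw [numCycles_one]
    simp
  have hc : (Nat.card (butterflyGroup p 0) : K) ≠ 0 := by exact_mod_cast Nat.card_pos.ne'
  rw [cyclePGF]
  simp only [h, pow_one, Finset.sum_const, Finset.card_univ, nsmul_eq_mul, ← Nat.card_eq_fintype_card]
  field_simp

/-- For `a = 0` cycle counts add, so the sum factors into a `p`-th power. For `a ≠ 0` the count is
that of an orbit product, which is uniform by `sum_orbitProd`. -/
theorem sum_butterfly_fiber {K : Type*} [Field K] [CharZero K] (p n : ℕ) [hp : Fact p.Prime] [Fintype (butterflyGroup p n)]
    (a : Fin p) (z : K) :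
    ∑ σ : Fin p → butterflyGroup p n, z ^ numCycles (butterflyEquiv p n (a, σ)).1 =
      (Nat.card (butterflyGroup p n) : K) ^ p *
        if a = 0 then cyclePGF (butterflyGroup p n) z ^ p else cyclePGF (butterflyGroup p n) z := by
  have hc : (Nat.card (butterflyGroup p n) : K) ≠ 0 := by exact_mod_cast Nat.card_pos.ne'
  have hG : (Nat.card (butterflyGroup p n) : K) * cyclePGF (butterflyGroup p n) z =
      ∑ g : butterflyGroup p n, z ^ numCycles g.1 := by
    rw [cyclePGF_eq, mul_inv_cancel_left₀ hc]
  simp only [butterflyEquiv_coe, numCycles_permCongr]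
  split_ifs with ha
  · subst ha
    have h1 : ∀ σ : Fin p → butterflyGroup p n,
        z ^ numCycles (skewPerm (finRotate p ^ ((0 : Fin p) : ℕ)) fun j => (σ j).1) =
          ∏ j, z ^ numCycles (σ j).1 := by
      intro σ
      rw [Finset.prod_pow_eq_pow_sum, Fin.val_zero, pow_zero, numCycles_skewPerm_one]
    rw [Finset.sum_congr rfl fun σ _ => h1 σ, ← mul_pow, hG, Fintype.sum_pow]
  · have ha' : ¬ p ∣ (a : ℕ) := fun h => ha (Fin.ext (Nat.eq_zero_of_dvd_of_lt h a.2))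
    have hper := finRotate_pow_pow_apply_zero_eq_zero_iff p a ha'
    have htr := exists_finRotate_pow_pow_apply_zero p a ha'
    have h1 : ∀ σ : Fin p → butterflyGroup p n,
        z ^ numCycles (skewPerm (finRotate p ^ (a : ℕ)) fun j => (σ j).1) =
          z ^ numCycles (orbitProd (finRotate p ^ (a : ℕ)) 0 σ p).1 := by
      intro σ
      rw [numCycles_skewPerm_of_transitive _ _ 0 p htr hper]
      exact congrArg (fun τ => z ^ numCycles τ)
        (map_orbitProd (butterflyGroup p n).subtype (finRotate p ^ (a : ℕ)) 0 σ p).symm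
    have h2 := sum_orbitProd (finRotate p ^ (a : ℕ)) 0 p hp.out.pos hper
      (fun g : butterflyGroup p n => z ^ numCycles g.1)
    rw [← hG] at h2
    simp only [nsmul_eq_mul, ← Nat.card_eq_fintype_card, Nat.card_fin, Nat.cast_pow] at h2
    rw [Finset.sum_congr rfl fun σ _ => h1 σ]
    refine mul_left_cancel₀ hc (h2.trans ?_)
    ring

theorem cyclePGF_butterflyGroup_succ {K : Type*} [Field K] [CharZero K] (p n : ℕ) [hp : Fact p.Prime] (z : K) :
    cyclePGF (butterflyGroup p (n + 1)) z = offspringPGF p (cyclePGF (butterflyGroup p n) z) := by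
  have := Fintype.ofFinite (butterflyGroup p n)
  have := Fintype.ofFinite (butterflyGroup p (n + 1))
  have hc : (Nat.card (butterflyGroup p n) : K) ≠ 0 := by exact_mod_cast Nat.card_pos.ne'
  have hp0 : (p : K) ≠ 0 := by exact_mod_cast hp.out.ne_zero
  rw [cyclePGF_eq, ← Equiv.sum_comp (butterflyEquiv p n), Fintype.sum_prod_type]
  simp only [sum_butterfly_fiber]
  rw [← Finset.mul_sum, ← Finset.add_sum_erase _ _ (Finset.mem_univ (0 : Fin p)), if_pos rfl,
    Finset.sum_congr rfl fun a ha => if_neg (Finset.ne_of_mem_erase ha), Finset.sum_const,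
    Finset.card_erase_of_mem (Finset.mem_univ _), Finset.card_univ, Fintype.card_fin,
    card_butterflyGroup_succ, nsmul_eq_mul, Nat.cast_sub hp.out.one_le, offspringPGF]
  push_cast
  field_simp
  ring

theorem cyclePGF_butterflyGroup {K : Type*} [Field K] [CharZero K] (p n : ℕ) [Fact p.Prime] (z : K) :
    cyclePGF (butterflyGroup p n) z = (offspringPGF p)^[n] z := by
  induction n with
  | zero => exact cyclePGF_butterflyGroup_zero p z
  | succ n ih => rw [cyclePGF_butterflyGroup_succ, ih, Function.iterate_succ_apply']

open scoped Pointwise in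
theorem cyclePGF_sylow {K : Type*} [Field K] [CharZero K] (p n : ℕ) [Fact p.Prime] (P : Sylow p (Equiv.Perm (Fin (p ^ n)))) (z : K) :
    cyclePGF (P : Subgroup (Equiv.Perm (Fin (p ^ n)))) z = (offspringPGF p)^[n] z := by
  obtain ⟨g, hg⟩ := MulAction.exists_smul_eq (Equiv.Perm (Fin (p ^ n))) P (butterflySylow p n)
  rw [← cyclePGF_butterflyGroup, ← coe_butterflySylow, ← hg]
  have := Fintype.ofFinite (P : Subgroup (Equiv.Perm (Fin (p ^ n))))
  have := Fintype.ofFinite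
    (MulAut.conj g • (P : Subgroup (Equiv.Perm (Fin (p ^ n)))) : Subgroup (Equiv.Perm (Fin (p ^ n))))
  let e := Subgroup.equivSMul (MulAut.conj g) (P : Subgroup (Equiv.Perm (Fin (p ^ n))))
  rw [Sylow.coe_subgroup_smul, cyclePGF_eq, cyclePGF_eq, ← Nat.card_congr e.toEquiv,
    ← Equiv.sum_comp e.toEquiv]
  refine congrArg _ (Finset.sum_congr rfl fun σ _ => ?_)
  exact congrArg (fun k => z ^ k) (numCycles_permCongr g σ.1).symm

/-! ### Integrals against the law of the scaled number of cycles -/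

/-- The growth rate of the expected number of cycles. -/
noncomputable def cycleGrowth (p : ℕ) : ℝ := 2 - 1 / (p : ℝ)

theorem one_lt_cycleGrowth {p : ℕ} (hp : 1 < p) : 1 < cycleGrowth p := by
  have h : (1 : ℝ) < p := by exact_mod_cast hp
  have := (div_lt_one (by linarith)).2 h
  unfold cycleGrowth
  linarith

theorem cycleGrowth_pos {p : ℕ} (hp : 1 < p) : 0 < cycleGrowth p :=
  zero_lt_one.trans (one_lt_cycleGrowth hp)

theorem cycleGrowth_lt_two {p : ℕ} (hp : 1 < p) : cycleGrowth p < 2 := by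
  have h : (0 : ℝ) < p := by exact_mod_cast (zero_lt_one.trans hp)
  have := div_pos one_pos h
  unfold cycleGrowth
  linarith

theorem coe_scaledCycleLaw (p n : ℕ) (H : Subgroup (Equiv.Perm (Fin (p ^ n)))) [hH : Fintype H]
    [MeasurableSpace H] [DiscreteMeasurableSpace H] :
    (scaledCycleLaw p n H : Measure ℝ) = (PMF.uniformOfFintype H).toMeasure.map
      fun σ : H => (numCycles (σ : Equiv.Perm (Fin (p ^ n))) : ℝ) / cycleGrowth p ^ n := by
  obtain rfl : hH = Fintype.ofFinite H := Subsingleton.elim _ _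
  rw [PMF.toMeasure_map (hf := .of_discrete)]
  unfold scaledCycleLaw
  rw [ProbabilityMeasure.coe_mk]
  congr!
  -- In `scaledCycleLaw` the coercion of `σ` is carried by a monadic bind that moves the uniform law
  -- to the whole symmetric group; here the two maps are merged.
  refine Eq.trans ?_ (PMF.map_comp Subtype.val _
    fun σ => (numCycles σ : ℝ) / cycleGrowth p ^ n)
  exact congrArg (PMF.map fun σ => (numCycles σ : ℝ) / cycleGrowth p ^ n)
    ((bind_pure_comp Subtype.val _).trans (PMF.monad_map_eq_map Subtype.val _))

theorem integral_scaledCycleLaw {E : Type*} [NormedAddCommGroup E] [NormedSpace ℝ E]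
    [CompleteSpace E] (p n : ℕ) (H : Subgroup (Equiv.Perm (Fin (p ^ n)))) [Fintype H] {g : ℝ → E}
    (hg : Continuous g) :
    Integrable g (scaledCycleLaw p n H : Measure ℝ) ∧ ∫ x, g x ∂(scaledCycleLaw p n H : Measure ℝ) =
      ∑ σ : H, (Nat.card H : ℝ)⁻¹ •
        g (numCycles (σ : Equiv.Perm (Fin (p ^ n))) / cycleGrowth p ^ n) := by
  let : MeasurableSpace H := ⊤
  set F : H → ℝ := fun σ => (numCycles (σ : Equiv.Perm (Fin (p ^ n))) : ℝ) / cycleGrowth p ^ n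
  have hF : Measurable F := measurable_from_top
  rw [coe_scaledCycleLaw]
  refine ⟨(integrable_map_measure hg.aestronglyMeasurable hF.aemeasurable).2 .of_finite, ?_⟩
  rw [integral_map hF.aemeasurable hg.aestronglyMeasurable, PMF.integral_eq_sum]
  simp [F]

theorem integral_cexp_scaledCycleLaw (p n : ℕ) (H : Subgroup (Equiv.Perm (Fin (p ^ n)))) (s : ℂ) :
    ∫ x : ℝ, Complex.exp (s * x) ∂(scaledCycleLaw p n H : Measure ℝ) =
      cyclePGF H (Complex.exp (s / (cycleGrowth p : ℂ) ^ n)) := by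
  have := Fintype.ofFinite H
  rw [(integral_scaledCycleLaw p n H (by fun_prop)).2, cyclePGF_eq, Finset.mul_sum]
  refine Finset.sum_congr rfl fun σ _ => ?_
  rw [← Complex.exp_nat_mul, Complex.real_smul]
  push_cast
  congr 2
  ring

theorem integral_exp_scaledCycleLaw (p n : ℕ) (H : Subgroup (Equiv.Perm (Fin (p ^ n)))) (s : ℝ) :
    Integrable (fun x => Real.exp (s * x)) (scaledCycleLaw p n H : Measure ℝ) ∧
    ∫ x : ℝ, Real.exp (s * x) ∂(scaledCycleLaw p n H : Measure ℝ) =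
      cyclePGF H (Real.exp (s / cycleGrowth p ^ n)) := by
  have := Fintype.ofFinite H
  have h := integral_scaledCycleLaw p n H (g := fun x => Real.exp (s * x)) (by fun_prop)
  refine ⟨h.1, ?_⟩
  rw [h.2, cyclePGF_eq, Finset.mul_sum]
  refine Finset.sum_congr rfl fun σ _ => ?_
  rw [← Real.exp_nat_mul, smul_eq_mul]
  congr 2
  ring

theorem charFun_scaledCycleLaw (p n : ℕ) [Fact p.Prime]
    (P : Sylow p (Equiv.Perm (Fin (p ^ n)))) (t : ℝ) :
    charFun (scaledCycleLaw p n (P : Subgroup (Equiv.Perm (Fin (p ^ n)))) : Measure ℝ) t =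
      (offspringPGF p)^[n] (Complex.exp (t * Complex.I / (cycleGrowth p : ℂ) ^ n)) := by
  rw [charFun_apply_real, ← cyclePGF_sylow p n P, ← integral_cexp_scaledCycleLaw]
  simp only [mul_right_comm]

theorem scaledCycleLaw_Ici (p n : ℕ) (hp : 1 < p) (H : Subgroup (Equiv.Perm (Fin (p ^ n)))) :
    (scaledCycleLaw p n H : Measure ℝ) (Set.Ici 0) = 1 := by
  let : Fintype H := Fintype.ofFinite H
  let : MeasurableSpace H := ⊤
  rw [coe_scaledCycleLaw, Measure.map_apply .of_discrete measurableSet_Ici]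
  convert measure_univ (μ := (PMF.uniformOfFintype H).toMeasure)
  · ext σ
    simp only [Set.mem_preimage, Set.mem_Ici, Set.mem_univ, iff_true]
    exact div_nonneg (Nat.cast_nonneg _) (pow_nonneg (cycleGrowth_pos hp).le _)

/-! ### Iterates of the offspring generating function -/

section Iterates

variable {p : ℕ}

theorem offspring_weights (hp : 1 < p) : (0 : ℝ) ≤ 1 - 1 / (p : ℝ) ∧ (0 : ℝ) ≤ 1 / (p : ℝ) := by
  have h : (1 : ℝ) < p := by exact_mod_cast hp
  have := (div_lt_one (by linarith)).2 h
  exact ⟨by linarith, by positivity⟩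

theorem norm_offspring_coeff (hp : 1 < p) :
    ‖(1 - 1 / (p : ℂ))‖ = 1 - 1 / (p : ℝ) ∧ ‖1 / (p : ℂ)‖ = 1 / (p : ℝ) := by
  constructor
  · rw [show (1 - 1 / (p : ℂ)) = ((1 - 1 / (p : ℝ) : ℝ) : ℂ) by push_cast; rfl, Complex.norm_real,
      Real.norm_of_nonneg (offspring_weights hp).1]
  · simp

theorem norm_offspringPGF_le_one (hp : 1 < p) {z : ℂ} (hz : ‖z‖ ≤ 1) : ‖offspringPGF p z‖ ≤ 1 := by
  obtain ⟨h1, h2⟩ := norm_offspring_coeff hp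
  obtain ⟨w1, w2⟩ := offspring_weights hp
  calc ‖offspringPGF p z‖ ≤ (1 - 1 / (p : ℝ)) * ‖z‖ + 1 / (p : ℝ) * ‖z‖ ^ p := by
        refine (norm_add_le _ _).trans_eq ?_
        rw [norm_mul, norm_mul, h1, h2, norm_pow]
    _ ≤ (1 - 1 / (p : ℝ)) * 1 + 1 / (p : ℝ) * 1 := by
        gcongr
        exact pow_le_one₀ (norm_nonneg z) hz
    _ = 1 := by ring

theorem norm_pow_sub_pow_le {z w : ℂ} (hz : ‖z‖ ≤ 1) (hw : ‖w‖ ≤ 1) (k : ℕ) :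
    ‖z ^ k - w ^ k‖ ≤ k * ‖z - w‖ := by
  induction k with
  | zero => simp
  | succ k ih =>
    calc ‖z ^ (k + 1) - w ^ (k + 1)‖ = ‖z ^ k * (z - w) + (z ^ k - w ^ k) * w‖ := by congr 1; ring
      _ ≤ ‖z‖ ^ k * ‖z - w‖ + ‖z ^ k - w ^ k‖ * ‖w‖ := by
        refine (norm_add_le _ _).trans_eq ?_
        rw [norm_mul, norm_mul, norm_pow]
      _ ≤ 1 * ‖z - w‖ + (k * ‖z - w‖) * 1 := by
        gcongr
        exact pow_le_one₀ (norm_nonneg z) hz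
      _ = _ := by push_cast; ring

/-- The coefficients are nonnegative, so on the closed unit disc the derivative is bounded by its
value `λ` at `1`. -/
theorem norm_offspringPGF_sub_le (hp : 1 < p) {z w : ℂ} (hz : ‖z‖ ≤ 1) (hw : ‖w‖ ≤ 1) :
    ‖offspringPGF p z - offspringPGF p w‖ ≤ cycleGrowth p * ‖z - w‖ := by
  obtain ⟨h1, h2⟩ := norm_offspring_coeff hp
  obtain ⟨w1, w2⟩ := offspring_weights hp
  have hp0 : (p : ℝ) ≠ 0 := by positivity
  calc ‖offspringPGF p z - offspringPGF p w‖
      = ‖(1 - 1 / (p : ℂ)) * (z - w) + 1 / (p : ℂ) * (z ^ p - w ^ p)‖ := by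
        unfold offspringPGF; congr 1; ring
    _ ≤ (1 - 1 / (p : ℝ)) * ‖z - w‖ + 1 / (p : ℝ) * ‖z ^ p - w ^ p‖ := by
        refine (norm_add_le _ _).trans_eq ?_
        rw [norm_mul, norm_mul, h1, h2]
    _ ≤ (1 - 1 / (p : ℝ)) * ‖z - w‖ + 1 / (p : ℝ) * (p * ‖z - w‖) := by
        gcongr
        exact norm_pow_sub_pow_le hz hw p
    _ = _ := by unfold cycleGrowth; field_simp; ring

theorem norm_offspringPGF_iterate_le_one (hp : 1 < p) {z : ℂ} (hz : ‖z‖ ≤ 1) (n : ℕ) :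
    ‖(offspringPGF p)^[n] z‖ ≤ 1 := by
  induction n with
  | zero => simpa
  | succ n ih => rw [Function.iterate_succ_apply']; exact norm_offspringPGF_le_one hp ih

theorem norm_offspringPGF_iterate_sub_le (hp : 1 < p) {z w : ℂ} (hz : ‖z‖ ≤ 1) (hw : ‖w‖ ≤ 1)
    (n : ℕ) : ‖(offspringPGF p)^[n] z - (offspringPGF p)^[n] w‖ ≤ cycleGrowth p ^ n * ‖z - w‖ := by
  induction n with
  | zero => simp
  | succ n ih =>
    rw [Function.iterate_succ_apply', Function.iterate_succ_apply', pow_succ', mul_assoc]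
    refine (norm_offspringPGF_sub_le hp (norm_offspringPGF_iterate_le_one hp hz n)
      (norm_offspringPGF_iterate_le_one hp hw n)).trans ?_
    have := (cycleGrowth_pos hp).le
    gcongr

/-- Taylor's bound for `|x| ≤ 1`; beyond that the trivial bound `2 + |x|` is at most `3 x²`. -/
theorem norm_exp_mul_I_sub_one_sub_le (x : ℝ) :
    ‖Complex.exp (x * Complex.I) - 1 - x * Complex.I‖ ≤ 3 * x ^ 2 := by
  have hn : ‖(x * Complex.I : ℂ)‖ = |x| := by simp
  rcases le_total |x| 1 with h | h
  · have := Complex.norm_exp_sub_one_sub_id_le (x := x * Complex.I) (by rwa [hn])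
    rw [hn, sq_abs] at this
    nlinarith [sq_nonneg x]
  · calc ‖Complex.exp (x * Complex.I) - 1 - x * Complex.I‖
        ≤ ‖Complex.exp (x * Complex.I)‖ + ‖(1 : ℂ)‖ + ‖(x * Complex.I : ℂ)‖ :=
          (norm_sub_le _ _).trans (add_le_add_left (norm_sub_le _ _) _)
      _ = 2 + |x| := by rw [Complex.norm_exp_ofReal_mul_I, hn, norm_one]; ring
      _ ≤ 3 * |x| ^ 2 := by nlinarith
      _ = _ := by rw [sq_abs]

/-- Both terms equal `1 + i λ x + O(x²)`, because `f'(1) = λ`. The `5` is `1 + 4`, from `λ² ≤ 4`. -/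
theorem norm_offspringPGF_exp_sub_le (hp : 1 < p) (x : ℝ) :
    ‖offspringPGF p (Complex.exp (x * Complex.I)) - Complex.exp ((cycleGrowth p * x : ℝ) * Complex.I)‖
      ≤ 3 * (5 + p) * x ^ 2 := by
  obtain ⟨h1, h2⟩ := norm_offspring_coeff hp
  obtain ⟨w1, w2⟩ := offspring_weights hp
  have hp0 : (p : ℝ) ≠ 0 := by positivity
  have hp0' : (p : ℂ) ≠ 0 := by exact_mod_cast hp0
  set r : ℝ → ℂ := fun y => Complex.exp (y * Complex.I) - 1 - y * Complex.I with hr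
  have hdecomp : offspringPGF p (Complex.exp (x * Complex.I)) -
      Complex.exp ((cycleGrowth p * x : ℝ) * Complex.I) =
      (1 - 1 / (p : ℂ)) * r x + 1 / (p : ℂ) * r (p * x) - r (cycleGrowth p * x) := by
    simp only [hr, offspringPGF, ← Complex.exp_nat_mul, cycleGrowth]
    push_cast
    rw [← mul_assoc]
    field_simp
    ring
  rw [hdecomp]
  have hg := (cycleGrowth_pos hp).le
  have hg2 := (cycleGrowth_lt_two hp).le
  calc _ ≤ (1 - 1 / (p : ℝ)) * ‖r x‖ + 1 / (p : ℝ) * ‖r (p * x)‖ + ‖r (cycleGrowth p * x)‖ := by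
        refine (norm_sub_le _ _).trans (add_le_add_left ((norm_add_le _ _).trans_eq ?_) _)
        rw [norm_mul, norm_mul, h1, h2]
    _ ≤ 1 * (3 * x ^ 2) + 1 / (p : ℝ) * (3 * (p * x) ^ 2) + 3 * (cycleGrowth p * x) ^ 2 := by
        gcongr
        · linarith
        · exact norm_exp_mul_I_sub_one_sub_le x
        · exact norm_exp_mul_I_sub_one_sub_le _
        · exact norm_exp_mul_I_sub_one_sub_le _
    _ = 3 * (1 + p + cycleGrowth p ^ 2) * x ^ 2 := by field_simp
    _ ≤ 3 * (5 + p) * x ^ 2 := by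
        refine mul_le_mul_of_nonneg_right ?_ (sq_nonneg x)
        nlinarith

/-- The innermost discrepancy is of order `t² / λ^(2n)`, and `n` iterations expand it by at most
`λ^n`. -/
theorem dist_offspringPGF_iterate_exp_le (hp : 1 < p) (t : ℝ) (n : ℕ) :
    dist ((offspringPGF p)^[n] (Complex.exp (t * Complex.I / (cycleGrowth p : ℂ) ^ n)))
      ((offspringPGF p)^[n + 1] (Complex.exp (t * Complex.I / (cycleGrowth p : ℂ) ^ (n + 1)))) ≤
      3 * (5 + p) * t ^ 2 * (cycleGrowth p)⁻¹ ^ n := by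
  have hg := one_lt_cycleGrowth hp
  have hg0 := cycleGrowth_pos hp
  have hgc : (cycleGrowth p : ℂ) ≠ 0 := by exact_mod_cast hg0.ne'
  set x : ℝ := t / cycleGrowth p ^ (n + 1) with hx
  have e1 : t * Complex.I / (cycleGrowth p : ℂ) ^ (n + 1) = x * Complex.I := by
    rw [hx]; push_cast; ring
  have e2 : t * Complex.I / (cycleGrowth p : ℂ) ^ n = (cycleGrowth p * x : ℝ) * Complex.I := by
    rw [hx]; push_cast; rw [pow_succ]; field_simp
  rw [dist_comm, dist_eq_norm, Function.iterate_succ_apply, e1, e2]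
  have hn : ∀ y : ℝ, ‖Complex.exp (y * Complex.I)‖ ≤ 1 := fun y =>
    (Complex.norm_exp_ofReal_mul_I y).le
  refine (norm_offspringPGF_iterate_sub_le hp (norm_offspringPGF_le_one hp (hn x)) (hn _) n).trans ?_
  calc _ ≤ cycleGrowth p ^ n * (3 * (5 + p) * x ^ 2) := by
        gcongr
        exact norm_offspringPGF_exp_sub_le hp x
    _ = 3 * (5 + p) * t ^ 2 * (cycleGrowth p)⁻¹ ^ n * ((cycleGrowth p)⁻¹) ^ 2 := by
        rw [hx, inv_pow, inv_pow]; field_simp; ring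
    _ ≤ 3 * (5 + p) * t ^ 2 * (cycleGrowth p)⁻¹ ^ n * 1 := by
        gcongr
        exact pow_le_one₀ (inv_nonneg.2 hg0.le) (inv_le_one_of_one_le₀ hg.le)
    _ = _ := mul_one _

/-- The limiting characteristic function. -/
noncomputable def limitCharFun (p : ℕ) (t : ℝ) : ℂ :=
  limUnder atTop fun n =>
    (offspringPGF p)^[n] (Complex.exp (t * Complex.I / (cycleGrowth p : ℂ) ^ n))

theorem tendsto_limitCharFun (hp : 1 < p) (t : ℝ) :
    Tendsto (fun n => (offspringPGF p)^[n] (Complex.exp (t * Complex.I / (cycleGrowth p : ℂ) ^ n)))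
      atTop (𝓝 (limitCharFun p t)) :=
  (cauchySeq_of_le_geometric _ _ (inv_lt_one_of_one_lt₀ (one_lt_cycleGrowth hp))
    (dist_offspringPGF_iterate_exp_le hp t)).tendsto_limUnder

/-- Sum the geometric bounds from `n = 0`, where the iterate is `exp (i t)`. The quadratic error
gives continuity at `0`, needed for Lévy's theorem, and the derivative there, hence the mean. -/
theorem exists_norm_limitCharFun_sub_le (hp : 1 < p) :
    ∃ C : ℝ, ∀ t : ℝ, ‖limitCharFun p t - Complex.exp (t * Complex.I)‖ ≤ C * t ^ 2 := by
  refine ⟨3 * (5 + p) / (1 - (cycleGrowth p)⁻¹), fun t => ?_⟩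
  have h := dist_le_of_le_geometric_of_tendsto₀ _ _ (inv_lt_one_of_one_lt₀ (one_lt_cycleGrowth hp))
    (dist_offspringPGF_iterate_exp_le hp t) (tendsto_limitCharFun hp t)
  rw [dist_comm, dist_eq_norm] at h
  simp only [pow_zero, div_one, Function.iterate_zero, id] at h
  exact h.trans_eq (by ring)

theorem limitCharFun_cycleGrowth_mul (hp : 1 < p) (t : ℝ) :
    limitCharFun p (cycleGrowth p * t) = offspringPGF p (limitCharFun p t) := by
  have hgc : (cycleGrowth p : ℂ) ≠ 0 := by exact_mod_cast (cycleGrowth_pos hp).ne'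
  have h1 := (tendsto_add_atTop_iff_nat 1).2 (tendsto_limitCharFun hp (cycleGrowth p * t))
  have hc : Continuous (offspringPGF p : ℂ → ℂ) := by unfold offspringPGF; fun_prop
  have h2 := (hc.tendsto _).comp (tendsto_limitCharFun hp t)
  refine tendsto_nhds_unique h1 (h2.congr fun n => ?_)
  simp only [Function.comp, ← Function.iterate_succ_apply']
  congr 2
  push_cast
  rw [pow_succ]
  field_simp

theorem hasDerivAt_limitCharFun_zero (hp : 1 < p) :
    HasDerivAt (limitCharFun p) Complex.I 0 := by
  obtain ⟨C, hC⟩ := exists_norm_limitCharFun_sub_le hp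
  have h1 : HasDerivAt (fun t : ℝ => limitCharFun p t - Complex.exp (t * Complex.I)) 0 0 := by
    have h0 := hC 0
    simp only [ne_eq, OfNat.ofNat_ne_zero, not_false_eq_true, zero_pow, mul_zero] at h0
    rw [hasDerivAt_iff_isLittleO_nhds_zero]
    simp only [zero_add, norm_le_zero_iff.1 h0, sub_zero, smul_zero]
    refine (Asymptotics.IsBigO.of_bound C (.of_forall fun t => ?_) :
      _ =O[𝓝 0] fun t : ℝ => t ^ 2).trans_isLittleO (Asymptotics.isLittleO_pow_id one_lt_two)
    simpa using hC t
  have h2 : HasDerivAt (fun t : ℝ => Complex.exp (t * Complex.I)) Complex.I 0 := by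
    have : HasDerivAt (fun t : ℝ => (t : ℂ) * Complex.I) (1 * Complex.I) 0 :=
      (Complex.ofRealCLM.hasDerivAt (x := (0 : ℝ))).mul_const Complex.I
    simpa using this.cexp
  simpa [Pi.add_def] using h1.add h2

end Iterates

/-! ### Existence of the limit law -/

/-- Lévy's continuity theorem, in the form that produces the limit law. -/
theorem exists_tendsto_of_tendsto_charFun {μ : ℕ → ProbabilityMeasure ℝ} {f : ℝ → ℂ}
    (hf : ContinuousAt f 0) (h : ∀ t, Tendsto (fun n => charFun (μ n : Measure ℝ) t) atTop (𝓝 (f t))) :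
    ∃ W : ProbabilityMeasure ℝ, charFun (W : Measure ℝ) = f ∧ Tendsto μ atTop (𝓝 W) := by
  have htight := isTightMeasureSet_of_tendsto_charFun hf h
  have hcomp : IsCompact (closure (Set.range μ)) :=
    isCompact_closure_of_isTightMeasureSet (by convert htight using 1; ext; simp)
  obtain ⟨W, -, φ, hφ, hW⟩ := hcomp.tendsto_subseq fun n => subset_closure (Set.mem_range_self n)
  have hchar : charFun (W : Measure ℝ) = f := funext fun t =>
    tendsto_nhds_unique (ProbabilityMeasure.tendsto_iff_tendsto_charFun.1 hW t)
      ((h t).comp hφ.tendsto_atTop)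
  exact ⟨W, hchar, ProbabilityMeasure.tendsto_iff_tendsto_charFun.2 fun t => by rw [hchar]; exact h t⟩

/-- Fatou's lemma for weak convergence: it carries exponential moment bounds to the limit law
although the exponential is unbounded. -/
theorem lintegral_le_of_tendsto_of_eventually_le {μ : ℕ → ProbabilityMeasure ℝ}
    {W : ProbabilityMeasure ℝ} (h : Tendsto μ atTop (𝓝 W)) {f : ℝ → ℝ} (hf : Continuous f)
    (hf0 : 0 ≤ f) {M : ENNReal}
    (hM : ∀ᶠ n in atTop, ∫⁻ x, ENNReal.ofReal (f x) ∂(μ n : Measure ℝ) ≤ M) :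
    ∫⁻ x, ENNReal.ofReal (f x) ∂(W : Measure ℝ) ≤ M := by
  refine (lintegral_le_liminf_lintegral_of_forall_isOpen_measure_le_liminf_measure
    (μs := fun n => (μ n : Measure ℝ)) hf hf0
    fun G hG => ProbabilityMeasure.le_liminf_measure_open_of_tendsto h hG).trans ?_
  exact liminf_le_of_frequently_le hM.frequently

theorem measure_closed_eq_one_of_tendsto {μ : ℕ → ProbabilityMeasure ℝ} {W : ProbabilityMeasure ℝ}
    (h : Tendsto μ atTop (𝓝 W)) {F : Set ℝ} (hF : IsClosed F) (hμ : ∀ n, (μ n : Measure ℝ) F = 1) :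
    (W : Measure ℝ) F = 1 := by
  refine le_antisymm prob_le_one ?_
  simpa [hμ] using ProbabilityMeasure.limsup_measure_closed_le_of_tendsto h hF

/-! ### Exponential moments -/

section ExponentialMoments

variable {p : ℕ}

theorem offspringPGF_nonneg (hp : 1 < p) {x : ℝ} (hx : 0 ≤ x) : 0 ≤ offspringPGF p x := by
  obtain ⟨w1, w2⟩ := offspring_weights hp
  unfold offspringPGF
  positivity

theorem offspringPGF_mono (hp : 1 < p) {x y : ℝ} (hx : 0 ≤ x) (hxy : x ≤ y) :
    offspringPGF p x ≤ offspringPGF p y := by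
  obtain ⟨w1, w2⟩ := offspring_weights hp
  unfold offspringPGF
  gcongr

theorem offspringPGF_iterate_nonneg (hp : 1 < p) {x : ℝ} (hx : 0 ≤ x) (n : ℕ) :
    0 ≤ (offspringPGF p)^[n] x := by
  induction n with
  | zero => simpa
  | succ n ih => rw [Function.iterate_succ_apply']; exact offspringPGF_nonneg hp ih

theorem offspringPGF_iterate_mono (hp : 1 < p) {x y : ℝ} (hx : 0 ≤ x) (hxy : x ≤ y) (n : ℕ) :
    (offspringPGF p)^[n] x ≤ (offspringPGF p)^[n] y := by
  induction n with
  | zero => simpa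
  | succ n ih =>
    rw [Function.iterate_succ_apply', Function.iterate_succ_apply']
    exact offspringPGF_mono hp (offspringPGF_iterate_nonneg hp hx n) ih

theorem offspringPGF_exp_le (hp : 1 < p) {y : ℝ} (hy : 0 ≤ y) (hpy : p * y ≤ 1) :
    offspringPGF p (Real.exp y) ≤ Real.exp (cycleGrowth p * y + (1 + p) * y ^ 2) := by
  have hp1 : (1 : ℝ) < p := by exact_mod_cast hp
  obtain ⟨w1, w2⟩ := offspring_weights hp
  have key : ∀ z : ℝ, 0 ≤ z → z ≤ 1 → Real.exp z ≤ 1 + z + z ^ 2 := by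
    intro z hz hz1
    have := Real.abs_exp_sub_one_sub_id_le (x := z) (by rwa [abs_of_nonneg hz])
    linarith [(abs_le.1 this).2]
  calc offspringPGF p (Real.exp y)
      = (1 - 1 / (p : ℝ)) * Real.exp y + 1 / (p : ℝ) * Real.exp (p * y) := by
        rw [offspringPGF, Real.exp_nat_mul]
    _ ≤ (1 - 1 / (p : ℝ)) * (1 + y + y ^ 2) + 1 / (p : ℝ) * (1 + p * y + (p * y) ^ 2) := by
        gcongr
        · exact key y hy (by nlinarith)
        · exact key _ (by positivity) hpy
    _ = (cycleGrowth p * y + (1 - 1 / (p : ℝ) + p) * y ^ 2) + 1 := by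
        unfold cycleGrowth; field_simp; ring
    _ ≤ (cycleGrowth p * y + (1 + p) * y ^ 2) + 1 := by
        gcongr
        linarith
    _ ≤ _ := Real.add_one_le_exp _

theorem exists_offspringPGF_iterate_exp_le_of_small (hp : 1 < p) :
    ∃ A > 0, ∃ s₀ > 0, ∀ n : ℕ, ∀ s : ℝ, 0 ≤ s → s ≤ s₀ →
      (offspringPGF p)^[n] (Real.exp (s / cycleGrowth p ^ n)) ≤ Real.exp (s + A * s ^ 2) := by
  have hg := one_lt_cycleGrowth hp
  have hg0 := cycleGrowth_pos hp
  have hp1 : (1 : ℝ) < p := by exact_mod_cast hp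
  set g := cycleGrowth p with hgdef
  have hg1 : 0 < g - 1 := by linarith
  -- Chosen so that `λ A + 4 (1 + p) = A (2 λ - 1) ≤ A λ²`: one application of `f` then preserves
  -- the quadratic term `A s²`.
  set A : ℝ := 4 * (1 + p) / (g - 1) with hA
  have hA0 : 0 < A := by positivity
  have hAg : A * (g - 1) = 4 * (1 + p) := by rw [hA]; field_simp
  -- `A s ≤ 1` gives `v + A v² ≤ 2 v` for `v = s / λ`; `2 p s ≤ 1` then puts `v + A v²` in the range
  -- of `offspringPGF_exp_le`.
  refine ⟨A, hA0, min A⁻¹ (2 * p : ℝ)⁻¹, by positivity, fun n => ?_⟩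
  induction n with
  | zero =>
    intro s hs _
    simp only [pow_zero, div_one, Function.iterate_zero, id]
    exact Real.exp_le_exp.2 (by nlinarith [mul_nonneg hA0.le (sq_nonneg s)])
  | succ n ih =>
    intro s hs hs0
    have hs1 : A * s ≤ 1 := by
      have := mul_le_mul_of_nonneg_left (hs0.trans (min_le_left _ _)) hA0.le
      rwa [mul_inv_cancel₀ hA0.ne'] at this
    have hs2 : 2 * p * s ≤ 1 := by
      have := mul_le_mul_of_nonneg_left (hs0.trans (min_le_right _ _)) (by positivity : (0 : ℝ) ≤ 2 * p)
      rwa [mul_inv_cancel₀ (by positivity)] at this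
    set v := s / g with hv
    have hsv : s = g * v := by rw [hv]; field_simp
    have hv0 : 0 ≤ v := by positivity
    have hvs : v ≤ s := by rw [hsv]; nlinarith
    have hAv : A * v ≤ 1 := (mul_le_mul_of_nonneg_left hvs hA0.le).trans hs1
    have h1 : (offspringPGF p)^[n] (Real.exp (s / g ^ (n + 1))) ≤ Real.exp (v + A * v ^ 2) := by
      have := ih v hv0 (hvs.trans hs0)
      rwa [hv, div_div, ← pow_succ'] at this
    have hu0 : 0 ≤ v + A * v ^ 2 := by positivity
    have hu2 : v + A * v ^ 2 ≤ 2 * v := by nlinarith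
    rw [Function.iterate_succ_apply']
    refine (offspringPGF_mono hp (offspringPGF_iterate_nonneg hp (Real.exp_nonneg _) n) h1).trans ?_
    refine (offspringPGF_exp_le hp hu0 ?_).trans (Real.exp_le_exp.2 ?_)
    · calc p * (v + A * v ^ 2) ≤ p * (2 * s) := by gcongr; linarith
        _ ≤ 1 := by linarith
    · rw [← hgdef]
      calc g * (v + A * v ^ 2) + (1 + p) * (v + A * v ^ 2) ^ 2
          ≤ g * (v + A * v ^ 2) + (1 + p) * (2 * v) ^ 2 := by gcongr
        _ = g * v + (g + (g - 1)) * (A * v ^ 2) := by linear_combination (-v ^ 2) * hAg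
        _ ≤ g * v + g ^ 2 * (A * v ^ 2) := by
          gcongr
          nlinarith [sq_nonneg (g - 1)]
        _ = s + A * s ^ 2 := by rw [hsv]; ring

/-- For fixed `k` with `s / λ^k ≤ s₀`, the inner `n - k` iterations obey the small-argument bound
and the outer `k` are a fixed monotone map. -/
theorem exists_offspringPGF_iterate_exp_le (hp : 1 < p) {s : ℝ} (hs : 0 ≤ s) :
    ∃ M : ℝ, ∀ᶠ n : ℕ in atTop, (offspringPGF p)^[n] (Real.exp (s / cycleGrowth p ^ n)) ≤ M := by
  have hg := one_lt_cycleGrowth hp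
  have hg0 := cycleGrowth_pos hp
  obtain ⟨A, hA, s₀, hs₀, h⟩ := exists_offspringPGF_iterate_exp_le_of_small hp
  obtain ⟨k, hk⟩ := pow_unbounded_of_one_lt (s / s₀) hg
  have hks : s / cycleGrowth p ^ k ≤ s₀ := by
    rw [div_lt_iff₀ hs₀] at hk
    rw [div_le_iff₀ (by positivity)]
    linarith
  refine ⟨(offspringPGF p)^[k] (Real.exp (s / cycleGrowth p ^ k + A * (s / cycleGrowth p ^ k) ^ 2)),
    (eventually_ge_atTop k).mono fun n hn => ?_⟩
  obtain ⟨m, rfl⟩ := Nat.exists_eq_add_of_le hn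
  rw [Function.iterate_add_apply]
  refine offspringPGF_iterate_mono hp (offspringPGF_iterate_nonneg hp (Real.exp_nonneg _) m) ?_ k
  have := h m _ (by positivity) hks
  rwa [div_div, ← pow_add] at this

end ExponentialMoments

/-- The properties of the limit law from which everything else follows. -/
structure IsCycleLimitLaw (p : ℕ) (W : Measure ℝ) : Prop where
  charFun_eq : charFun W = limitCharFun p
  ae_nonneg : ∀ᵐ x ∂W, 0 ≤ x
  integrable_exp : ∀ s : ℝ, Integrable (fun x => Real.exp (s * x)) W

theorem exists_isCycleLimitLaw (p : ℕ) [hp : Fact p.Prime] :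
    ∃ W : ProbabilityMeasure ℝ, IsCycleLimitLaw p W ∧
      ∀ P : (n : ℕ) → Sylow p (Equiv.Perm (Fin (p ^ n))),
        Tendsto (fun n => scaledCycleLaw p n (P n : Subgroup (Equiv.Perm (Fin (p ^ n))))) atTop (𝓝 W) := by
  have hp1 := hp.out.one_lt
  have hlim : ∀ (P : (n : ℕ) → Sylow p (Equiv.Perm (Fin (p ^ n)))) (t : ℝ), Tendsto
      (fun n => charFun (scaledCycleLaw p n (P n : Subgroup (Equiv.Perm (Fin (p ^ n)))) : Measure ℝ) t)
      atTop (𝓝 (limitCharFun p t)) := fun P t => by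
    simp only [charFun_scaledCycleLaw]
    exact tendsto_limitCharFun hp1 t
  obtain ⟨W, hW, hconv⟩ := exists_tendsto_of_tendsto_charFun
    (hasDerivAt_limitCharFun_zero hp1).continuousAt (hlim fun n => butterflySylow p n)
  have hnn : ∀ᵐ x ∂(W : Measure ℝ), 0 ≤ x := by
    have := measure_closed_eq_one_of_tendsto hconv isClosed_Ici
      fun n => scaledCycleLaw_Ici p n hp1 _
    exact (mem_ae_iff_prob_eq_one measurableSet_Ici).2 this
  have hpos : ∀ s : ℝ, 0 ≤ s → Integrable (fun x => Real.exp (s * x)) (W : Measure ℝ) := by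
    intro s hs
    obtain ⟨M, hM⟩ := exists_offspringPGF_iterate_exp_le hp1 hs
    refine ⟨by fun_prop, ?_⟩
    rw [hasFiniteIntegral_iff_ofReal (.of_forall fun _ => Real.exp_nonneg _)]
    refine (lintegral_le_of_tendsto_of_eventually_le (M := ENNReal.ofReal M) hconv (by fun_prop)
      (fun _ => Real.exp_nonneg _) (hM.mono fun n hn => ?_)).trans_lt ENNReal.ofReal_lt_top
    obtain ⟨h1, h2⟩ := integral_exp_scaledCycleLaw p n
      (butterflySylow p n : Subgroup (Equiv.Perm (Fin (p ^ n)))) s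
    rw [← ofReal_integral_eq_lintegral_ofReal h1 (.of_forall fun _ => Real.exp_nonneg _), h2,
      cyclePGF_sylow]
    exact ENNReal.ofReal_le_ofReal hn
  refine ⟨W, ⟨hW, hnn, fun s => ?_⟩, fun P => ?_⟩
  -- On `[0, ∞)` the exponential with rate `s` is dominated by the one with rate `|s|`.
  · refine (hpos |s| (abs_nonneg s)).mono' (by fun_prop) (hnn.mono fun x hx => ?_)
    rw [Real.norm_of_nonneg (Real.exp_nonneg _)]
    exact Real.exp_le_exp.2 (mul_le_mul_of_nonneg_right (le_abs_self s) hx)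
  · exact ProbabilityMeasure.tendsto_iff_tendsto_charFun.2 fun t => by rw [hW]; exact hlim P t

/-! ### Determinacy by moments -/

theorem charFun_eq_tsum_moments {μ : Measure ℝ} (hμ : ∀ᵐ x ∂μ, 0 ≤ x)
    (hint : ∀ k : ℕ, Integrable (fun x => x ^ k) μ)
    (hsum : ∀ t : ℝ, Summable fun k : ℕ => t ^ k / k.factorial * ∫ x, x ^ k ∂μ) (t : ℝ) :
    charFun μ t = ∑' k : ℕ, (t * Complex.I) ^ k / k.factorial * ((∫ x, x ^ k ∂μ : ℝ) : ℂ) := by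
  set F : ℕ → ℝ → ℂ := fun k x => (t * Complex.I) ^ k / k.factorial * ((x ^ k : ℝ) : ℂ)
  have hF : ∀ k, Integrable (F k) μ := fun k => (hint k).ofReal.const_mul _
  have hnorm : ∀ k, ∫ x, ‖F k x‖ ∂μ = |t| ^ k / k.factorial * ∫ x, x ^ k ∂μ := by
    intro k
    rw [← integral_const_mul]
    refine integral_congr_ae (hμ.mono fun x hx => ?_)
    simp [F, abs_of_nonneg hx]
  have h := (hasSum_integral_of_summable_integral_norm hF (by simpa only [hnorm] using hsum |t|)).tsum_eq
  rw [charFun_apply_real]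
  calc ∫ x : ℝ, Complex.exp (t * x * Complex.I) ∂μ = ∫ x, ∑' k, F k x ∂μ := by
        refine integral_congr_ae (.of_forall fun x => ?_)
        simp only [F]
        rw [Complex.exp_eq_exp_ℂ, NormedSpace.exp_eq_tsum_div]
        refine tsum_congr fun k => ?_
        push_cast
        ring
    _ = ∑' k, ∫ x, F k x ∂μ := h.symm
    _ = _ := tsum_congr fun k => by rw [integral_const_mul, integral_complex_ofReal]

theorem summable_moments {μ : Measure ℝ} (hμ : ∀ᵐ x ∂μ, 0 ≤ x)
    (hint : ∀ k : ℕ, Integrable (fun x => x ^ k) μ)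
    (hexp : ∀ s : ℝ, Integrable (fun x => Real.exp (s * x)) μ) (t : ℝ) :
    Summable fun k : ℕ => t ^ k / k.factorial * ∫ x, x ^ k ∂μ := by
  have hnn : ∀ k : ℕ, 0 ≤ ∫ x, x ^ k ∂μ := fun k =>
    integral_nonneg_of_ae (hμ.mono fun x hx => pow_nonneg hx k)
  have habs : Summable fun k : ℕ => |t| ^ k / k.factorial * ∫ x, x ^ k ∂μ := by
    refine summable_of_sum_range_le (c := ∫ x, Real.exp (|t| * x) ∂μ)
      (fun k => mul_nonneg (by positivity) (hnn k)) fun n => ?_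
    simp only [← integral_const_mul]
    rw [← integral_finsetSum _ fun k _ => (hint k).const_mul _]
    refine integral_mono_ae (integrable_finsetSum _ fun k _ => (hint k).const_mul _) (hexp _)
      (hμ.mono fun x hx => ?_)
    refine le_trans (le_of_eq (Finset.sum_congr rfl fun k _ => ?_))
      (Real.sum_le_exp_of_nonneg (mul_nonneg (abs_nonneg t) hx) n)
    rw [mul_pow]; ring
  refine Summable.of_norm (habs.congr fun k => ?_)
  rw [norm_mul, norm_div, norm_pow, Real.norm_eq_abs, Real.norm_of_nonneg (hnn k),
    Real.norm_of_nonneg (Nat.cast_nonneg _)]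

/-- The power series of `charFun μ` in the moments converges absolutely. On `[0, ∞)` the absolute
moments are the moments, so summability passes to `ν`, which needs no exponential moments of its
own. -/
theorem ext_of_moments {μ ν : Measure ℝ} [IsFiniteMeasure μ] [IsFiniteMeasure ν]
    (hμ : ∀ᵐ x ∂μ, 0 ≤ x) (hν : ∀ᵐ x ∂ν, 0 ≤ x)
    (hμi : ∀ k : ℕ, Integrable (fun x => x ^ k) μ) (hνi : ∀ k : ℕ, Integrable (fun x => x ^ k) ν)
    (hexp : ∀ s : ℝ, Integrable (fun x => Real.exp (s * x)) μ)
    (h : ∀ k : ℕ, ∫ x, x ^ k ∂ν = ∫ x, x ^ k ∂μ) : ν = μ := by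
  have hs := summable_moments hμ hμi hexp
  refine Measure.ext_of_charFun (funext fun t => ?_)
  rw [charFun_eq_tsum_moments hμ hμi hs, charFun_eq_tsum_moments hν hνi (by simpa only [h] using hs)]
  simp only [h]

/-! ### The fixed point equation -/

theorem measure_pi_pos_of_mem_nhds {ι : Type*} [Fintype ι] {W : Measure ℝ} [SigmaFinite W]
    {x : ι → ℝ} (hx : ∀ i, x i ∈ W.support) {V : Set (ι → ℝ)} (hV : V ∈ 𝓝 x) :
    0 < Measure.pi (fun _ => W) V := by
  rw [nhds_pi, Filter.mem_pi'] at hV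
  obtain ⟨I, U, hU, hsub⟩ := hV
  refine lt_of_lt_of_le ?_ (measure_mono ((Set.pi_mono' (fun _ _ => le_rfl) (Set.subset_univ _)).trans hsub))
  rw [Measure.pi_pi]
  exact CanonicallyOrderedAdd.prod_pos.2 fun i _ =>
    (Measure.mem_support_iff_forall (x i)).1 (hx i) _ (hU i)

theorem exists_fin_sum_eq (q N : ℕ) {j : ℕ} (hj : j ≤ q * N) :
    ∃ a : Fin q → ℕ, (∀ l, a l ≤ N) ∧ ∑ l, a l = j := by
  induction q generalizing j with
  | zero => exact ⟨fun _ => 0, by simp, by simp; omega⟩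
  | succ q ih =>
    obtain ⟨a, ha, hs⟩ := ih (j := j - min j N) (by rw [Nat.succ_mul] at hj; omega)
    refine ⟨Fin.cons (min j N) a, fun l => ?_, ?_⟩
    · refine Fin.cases ?_ (fun l => ?_) l
      · simp
      · simpa using ha l
    · rw [Fin.sum_univ_succ]
      simp [hs]

namespace IsCycleLimitLaw

variable {p : ℕ} {W : Measure ℝ}

theorem integrable_pow (h : IsCycleLimitLaw p W) (k : ℕ) : Integrable (fun x => x ^ k) W :=
  ProbabilityTheory.integrable_pow_of_integrable_exp_mul (X := fun x => x) one_ne_zero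
    (h.integrable_exp 1) (h.integrable_exp (-1)) k

theorem integral_id (h : IsCycleLimitLaw p W) [IsProbabilityMeasure W] (hp : 1 < p) :
    ∫ x, x ∂W = 1 := by
  have hL : MemLp id 1 W := memLp_one_iff_integrable.2 (by simpa using! h.integrable_pow 1)
  have h1 := iteratedDeriv_charFun_zero (n := 1) (μ := W) (by exact_mod_cast hL)
  rw [iteratedDeriv_one, h.charFun_eq, (hasDerivAt_limitCharFun_zero hp).deriv] at h1
  simp only [pow_one] at h1
  have h2 := mul_left_cancel₀ Complex.I_ne_zero ((mul_one _).trans h1)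
  exact_mod_cast h2.symm

/-- This is `limitCharFun_cycleGrowth_mul` at `t / λ`: a `p`-th power of a characteristic function
belongs to a sum of `p` independent copies. -/
theorem eq_mixture (h : IsCycleLimitLaw p W) [IsProbabilityMeasure W] (hp : 1 < p) :
    W = (1 - 1 / (p : ℝ)).toNNReal • W.map (fun x => (cycleGrowth p)⁻¹ * x) +
      (1 / (p : ℝ)).toNNReal • (Measure.pi fun _ : Fin p => W).map
        (fun x => (cycleGrowth p)⁻¹ * ∑ i, x i) := by
  obtain ⟨w1, w2⟩ := offspring_weights hp
  have hg := (cycleGrowth_pos hp).ne'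
  have hm : (Measure.pi fun _ : Fin p => W).map (fun x => (cycleGrowth p)⁻¹ * ∑ i, x i) =
      ((Measure.pi fun _ : Fin p => W).map fun x => ∑ i, x i).map ((cycleGrowth p)⁻¹ * ·) := by
    rw [Measure.map_map (by fun_prop) (by fun_prop)]
    rfl
  have hprob : IsProbabilityMeasure ((Measure.pi fun _ : Fin p => W).map fun x => ∑ i, x i) :=
    Measure.isProbabilityMeasure_map (by fun_prop)
  have hprob' : ∀ μ : Measure ℝ, IsProbabilityMeasure μ →
    IsProbabilityMeasure (μ.map ((cycleGrowth p)⁻¹ * ·)) := fun μ _ =>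
      Measure.isProbabilityMeasure_map (by fun_prop)
  have hi : ∀ (μ : Measure ℝ) (t : ℝ), IsProbabilityMeasure μ →
      Integrable (fun x : ℝ => Complex.exp (t * x * Complex.I)) μ := fun μ t _ =>
    Integrable.of_bound (by fun_prop) 1 (.of_forall fun x => by
      rw [← Complex.ofReal_mul, Complex.norm_exp_ofReal_mul_I])
  rw [hm]
  have i1 := hprob' W inferInstance
  have i2 := hprob' _ hprob
  refine Measure.ext_of_charFun (funext fun t => ?_)
  rw [charFun_apply_real (μ := _ + _), integral_add_measure, integral_smul_nnreal_measure,
    integral_smul_nnreal_measure, ← charFun_apply_real, ← charFun_apply_real, charFun_map_mul,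
    charFun_map_mul, ProbabilityTheory.charFun_map_sum_pi_eq_prod]
  · have := limitCharFun_cycleGrowth_mul hp ((cycleGrowth p)⁻¹ * t)
    rw [mul_inv_cancel_left₀ hg] at this
    simp only [Finset.prod_const, Finset.card_univ, Fintype.card_fin, Pi.pow_apply]
    rw [h.charFun_eq, this, offspringPGF, NNReal.smul_def, NNReal.smul_def, Real.coe_toNNReal _ w1,
      Real.coe_toNNReal _ w2, Complex.real_smul, Complex.real_smul]
    push_cast
    rfl
  · exact (hi _ t i1).smul_measure_nnreal
  · exact (hi _ t i2).smul_measure_nnreal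

/-! ### Moments -/

theorem integral_pow_eq (h : IsCycleLimitLaw p W) [IsProbabilityMeasure W] (hp : 1 < p) (k : ℕ) :
    ∫ x, x ^ k ∂W = ((cycleGrowth p)⁻¹) ^ k * ((1 - 1 / (p : ℝ)) * ∫ x, x ^ k ∂W +
      1 / (p : ℝ) * ∑ i ∈ Finset.piAntidiag (Finset.univ : Finset (Fin p)) k,
        (Nat.multinomial Finset.univ i : ℝ) * ∏ l, ∫ x, x ^ i l ∂W) := by
  obtain ⟨w1, w2⟩ := offspring_weights hp
  have hprod : ∀ i : Fin p → ℕ, Integrable (fun x : Fin p → ℝ => ∏ l, x l ^ i l)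
      (Measure.pi fun _ => W) := fun i =>
    Integrable.fintype_prod_dep (f := fun l x => x ^ i l) fun l => h.integrable_pow (i l)
  have hexpand : ∀ x : Fin p → ℝ, (∑ l, x l) ^ k =
      ∑ i ∈ Finset.piAntidiag (Finset.univ : Finset (Fin p)) k,
        (Nat.multinomial Finset.univ i : ℝ) * ∏ l, x l ^ i l := fun x =>
    Finset.sum_pow_eq_sum_piAntidiag _ _ _
  have hsumint : Integrable (fun x : Fin p → ℝ => (∑ l, x l) ^ k) (Measure.pi fun _ => W) := by
    simp only [hexpand]
    exact integrable_finsetSum _ fun i _ => (hprod i).const_mul _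
  have hsum : ∫ x : Fin p → ℝ, (∑ l, x l) ^ k ∂(Measure.pi fun _ => W) =
      ∑ i ∈ Finset.piAntidiag (Finset.univ : Finset (Fin p)) k,
        (Nat.multinomial Finset.univ i : ℝ) * ∏ l, ∫ x, x ^ i l ∂W := by
    simp only [hexpand]
    rw [integral_finsetSum _ fun i _ => (hprod i).const_mul _]
    refine Finset.sum_congr rfl fun i _ => ?_
    rw [integral_const_mul, integral_fintype_prod_eq_prod (f := fun l x => x ^ i l)]
  conv_lhs => rw [h.eq_mixture hp]
  rw [integral_add_measure, integral_smul_nnreal_measure, integral_smul_nnreal_measure,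
    integral_map (by fun_prop) (by fun_prop), integral_map (by fun_prop) (by fun_prop)]
  · simp only [mul_pow]
    rw [integral_const_mul, integral_const_mul, hsum, NNReal.smul_def, NNReal.smul_def,
      Real.coe_toNNReal _ w1, Real.coe_toNNReal _ w2, smul_eq_mul, smul_eq_mul]
    ring
  · refine Integrable.smul_measure_nnreal ((integrable_map_measure (by fun_prop) (by fun_prop)).2 ?_)
    simpa only [Function.comp_def, mul_pow] using (h.integrable_pow k).const_mul _
  · refine Integrable.smul_measure_nnreal ((integrable_map_measure (by fun_prop) (by fun_prop)).2 ?_)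
    simpa only [Function.comp_def, mul_pow] using hsumint.const_mul _

end IsCycleLimitLaw

/-- The indices left out by the filter are the `p` vectors `Pi.single l k`, distinct as `k ≠ 0`;
each has multinomial coefficient `1` and product `m k`. -/
theorem sum_piAntidiag_eq_add (p : ℕ) {k : ℕ} (hk : k ≠ 0) (m : ℕ → ℝ) (h0 : m 0 = 1) :
    ∑ i ∈ Finset.piAntidiag (Finset.univ : Finset (Fin p)) k,
        (Nat.multinomial Finset.univ i : ℝ) * ∏ l, m (i l) =
      ∑ i ∈ (Finset.piAntidiag (Finset.univ : Finset (Fin p)) k).filter (fun i => ∀ l, i l < k),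
        (Nat.multinomial Finset.univ i : ℝ) * ∏ l, m (i l) + p * m k := by
  rw [← Finset.sum_filter_add_sum_filter_not _ (fun i : Fin p → ℕ => ∀ l, i l < k)]
  congr 1
  have hset : (Finset.piAntidiag (Finset.univ : Finset (Fin p)) k).filter (fun i => ¬ ∀ l, i l < k) =
      Finset.univ.image fun l : Fin p => (Pi.single l k : Fin p → ℕ) := by
    ext i
    simp only [Finset.mem_filter, Finset.mem_piAntidiag, Finset.mem_image, Finset.mem_univ, true_and,
      not_forall, not_lt, implies_true, and_true]
    constructor
    · rintro ⟨hs, l, hl⟩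
      refine ⟨l, funext fun j => ?_⟩
      have h1 := Finset.add_sum_erase Finset.univ i (Finset.mem_univ l)
      rw [hs] at h1
      rcases eq_or_ne j l with rfl | hj
      · rw [Pi.single_eq_same]; omega
      · have h2 := Finset.single_le_sum (f := i) (fun _ _ => Nat.zero_le _)
          (Finset.mem_erase.2 ⟨hj, Finset.mem_univ j⟩)
        rw [Pi.single_eq_of_ne hj]
        omega
    · rintro ⟨l, rfl⟩
      exact ⟨by simp, l, by simp⟩
  rw [hset, Finset.sum_image fun a _ b _ hab => by
    by_contra hne
    have := congrFun hab a
    simp only [Pi.single_eq_same, Pi.single_eq_of_ne hne] at this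
    exact hk this]
  have hterm : ∀ l : Fin p, (Nat.multinomial Finset.univ (Pi.single l k : Fin p → ℕ) : ℝ) *
      ∏ j, m ((Pi.single l k : Fin p → ℕ) j) = m k := by
    intro l
    rw [Finset.prod_eq_single l (fun j _ hj => by rw [Pi.single_eq_of_ne hj, h0]) (by simp),
      Pi.single_eq_same]
    have : Nat.multinomial Finset.univ (Pi.single l k : Fin p → ℕ) = 1 := by
      have hspec := Nat.multinomial_spec Finset.univ (Pi.single l k : Fin p → ℕ)
      rw [Finset.prod_eq_single l (fun j _ hj => by rw [Pi.single_eq_of_ne hj, Nat.factorial_zero])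
        (by simp), Pi.single_eq_same, Finset.sum_pi_single' l k] at hspec
      simpa [Nat.factorial_ne_zero] using hspec
    rw [this, Nat.cast_one, one_mul]
  simp [hterm]

namespace IsCycleLimitLaw

variable {p : ℕ} {W : Measure ℝ}

theorem moment_recursion (h : IsCycleLimitLaw p W) [IsProbabilityMeasure W] (hp : 1 < p) {k : ℕ}
    (hk : 2 ≤ k) :
    ∫ x, x ^ k ∂W = 1 / ((p : ℝ) - 1) *
      ((cycleGrowth p - 1) / (cycleGrowth p ^ k - cycleGrowth p)) *
      ∑ i ∈ (Finset.piAntidiag (Finset.univ : Finset (Fin p)) k).filter (fun i => ∀ l, i l < k),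
        (Nat.multinomial Finset.univ i : ℝ) * ∏ l, ∫ x, x ^ i l ∂W := by
  have hg := one_lt_cycleGrowth hp
  have hg0 := (cycleGrowth_pos hp).ne'
  have hp1 : (1 : ℝ) < p := by exact_mod_cast hp
  have hp0 : (p : ℝ) ≠ 0 := by positivity
  have hp2 : (p : ℝ) - 1 ≠ 0 := by linarith
  have hlt : cycleGrowth p < cycleGrowth p ^ k := by
    simpa using pow_lt_pow_right₀ hg (show 1 < k by omega)
  have hne : cycleGrowth p ^ k - cycleGrowth p ≠ 0 := by linarith
  have h1 := h.integral_pow_eq hp k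
  rw [sum_piAntidiag_eq_add p (by omega) (fun k => ∫ x, x ^ k ∂W) (by simp)] at h1
  set T := ∑ i ∈ (Finset.piAntidiag (Finset.univ : Finset (Fin p)) k).filter (fun i => ∀ l, i l < k),
        (Nat.multinomial Finset.univ i : ℝ) * ∏ l, ∫ x, x ^ i l ∂W
  set M := ∫ x, x ^ k ∂W
  have h2 : cycleGrowth p ^ k * M = (1 - 1 / (p : ℝ)) * M + 1 / (p : ℝ) * (T + p * M) := by
    conv_lhs => rw [h1]
    rw [inv_pow, mul_inv_cancel_left₀ (pow_ne_zero _ hg0)]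
  -- The coefficients of `M` on the right of `h2` add up to `(1 - 1/p) + 1 = λ`.
  have h3 : (cycleGrowth p ^ k - cycleGrowth p) * M = 1 / (p : ℝ) * T := by
    rw [sub_mul, h2]
    unfold cycleGrowth
    field_simp
    ring
  have h4 : 1 / ((p : ℝ) - 1) * (cycleGrowth p - 1) = 1 / (p : ℝ) := by
    unfold cycleGrowth
    field_simp
    ring
  rw [← mul_div_assoc, h4, div_mul_eq_mul_div, ← h3, mul_div_cancel_left₀ _ hne]

/-! ### No atom at zero -/

/-- By `eq_mixture` the mass `q` at `0` is a fixed point of `f`, so `q^p = q` and `q` is `0` or `1`;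
the value `1` contradicts the mean `1`. -/
theorem measure_singleton_zero (h : IsCycleLimitLaw p W) [IsProbabilityMeasure W] (hp : 1 < p) :
    W {0} = 0 := by
  obtain ⟨w1, w2⟩ := offspring_weights hp
  have hp1 : (1 : ℝ) < p := by exact_mod_cast hp
  have hg := (cycleGrowth_pos hp).ne'
  have hpi : (Measure.pi fun _ : Fin p => W) {x | ∑ i, x i = 0} = W {0} ^ p := by
    have hnn : ∀ᵐ x ∂(Measure.pi fun _ : Fin p => W), ∀ i, 0 ≤ x i :=
      ae_all_iff.2 fun i => (Measure.quasiMeasurePreserving_eval (fun _ => W) i).ae h.ae_nonneg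
    calc _ = (Measure.pi fun _ : Fin p => W) (Set.univ.pi fun _ => {0}) := by
          refine measure_congr (hnn.mono fun x hx => propext ?_)
          change ∑ i, x i = 0 ↔ x ∈ Set.univ.pi fun _ => {0}
          rw [Finset.sum_eq_zero_iff_of_nonneg fun i _ => hx i]
          simp
      _ = _ := by rw [Measure.pi_pi]; simp
  have hq : W.real {0} = (1 - 1 / (p : ℝ)) * W.real {0} + 1 / (p : ℝ) * W.real {0} ^ p := by
    have hme := congrArg (fun μ : Measure ℝ => (μ {0}).toReal) (h.eq_mixture hp)
    simp only [Measure.add_apply, Measure.smul_apply, ENNReal.smul_def, smul_eq_mul] at hme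
    rw [Measure.map_apply (by fun_prop) (measurableSet_singleton 0),
      Measure.map_apply (by fun_prop) (measurableSet_singleton 0)] at hme
    have e1 : (fun x => (cycleGrowth p)⁻¹ * x) ⁻¹' {0} = {0} := by ext; simp [hg]
    have e2 : (fun x : Fin p → ℝ => (cycleGrowth p)⁻¹ * ∑ i, x i) ⁻¹' {0} = {x | ∑ i, x i = 0} := by
      ext; simp [hg]
    rw [e1, e2, hpi, ENNReal.toReal_add (by finiteness) (by finiteness)] at hme
    simpa [Measure.real, ENNReal.toReal_mul, Real.coe_toNNReal _ w1, Real.coe_toNNReal _ w2,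
      -one_div, -Real.coe_toNNReal'] using hme
  have hq1 : W.real {0} ^ p = W.real {0} := by
    have : 1 / (p : ℝ) ≠ 0 := by positivity
    refine mul_left_cancel₀ this ?_
    linarith
  have hq0 : 0 ≤ W.real {0} := measureReal_nonneg
  have hle : W.real {0} ≤ 1 := measureReal_le_one
  rcases hq0.eq_or_lt with h0 | h0
  · exact (measureReal_eq_zero_iff).1 h0.symm
  exfalso
  rcases hle.eq_or_lt with h1 | h1
  · have hae : ∀ᵐ x ∂W, x = 0 := by
      refine (mem_ae_iff_prob_eq_one (measurableSet_singleton (0 : ℝ))).2 ?_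
      rw [← ENNReal.toReal_eq_one_iff]; exact h1
    have := h.integral_id hp
    rw [integral_congr_ae (g := fun _ => (0 : ℝ)) hae] at this
    simp at this
  · have := pow_lt_pow_right_of_lt_one₀ h0 h1 hp
    rw [hq1, pow_one] at this
    exact lt_irrefl _ this

theorem measure_Ioi (h : IsCycleLimitLaw p W) [IsProbabilityMeasure W] (hp : 1 < p) :
    W (Set.Ioi 0) = 1 := by
  refine (mem_ae_iff_prob_eq_one measurableSet_Ioi).1 ?_
  have h0 : ∀ᵐ x ∂W, x ≠ 0 := compl_mem_ae_iff.2 (h.measure_singleton_zero hp)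
  filter_upwards [h.ae_nonneg, h0] with x hx hx0 using lt_of_le_of_ne hx hx0.symm

/-! ### Full support -/

theorem inv_mul_mem_support (h : IsCycleLimitLaw p W) [IsProbabilityMeasure W] (hp : 1 < p) {x : ℝ}
    (hx : x ∈ W.support) : (cycleGrowth p)⁻¹ * x ∈ W.support := by
  have w1 : 0 < 1 - 1 / (p : ℝ) := sub_pos.2 ((div_lt_one (by positivity)).2 (by exact_mod_cast hp))
  rw [Measure.mem_support_iff_forall] at hx ⊢
  intro V hV
  have hpre : (fun x => (cycleGrowth p)⁻¹ * x) ⁻¹' V ∈ 𝓝 x :=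
    (by fun_prop : Continuous fun x => (cycleGrowth p)⁻¹ * x).continuousAt hV
  rw [h.eq_mixture hp]
  refine lt_of_lt_of_le ?_ (Measure.le_iff'.1 (Measure.le_add_right le_rfl) V)
  rw [Measure.smul_apply]
  exact ENNReal.mul_pos (by simpa using w1)
    ((hx _ hpre).trans_le (Measure.le_map_apply (by fun_prop) V)).ne'

theorem inv_mul_sum_mem_support (h : IsCycleLimitLaw p W) [IsProbabilityMeasure W] (hp : 1 < p)
    {x : Fin p → ℝ} (hx : ∀ i, x i ∈ W.support) : (cycleGrowth p)⁻¹ * ∑ i, x i ∈ W.support := by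
  rw [Measure.mem_support_iff_forall]
  intro V hV
  have hpre : (fun x : Fin p → ℝ => (cycleGrowth p)⁻¹ * ∑ i, x i) ⁻¹' V ∈ 𝓝 x :=
    (by fun_prop : Continuous fun x : Fin p → ℝ => (cycleGrowth p)⁻¹ * ∑ i, x i).continuousAt hV
  rw [h.eq_mixture hp]
  refine lt_of_lt_of_le ?_ (Measure.le_iff'.1 (Measure.le_add_left le_rfl) V)
  rw [Measure.smul_apply]
  exact ENNReal.mul_pos (by simpa using ne_of_gt (zero_lt_one.trans hp))
    ((measure_pi_pos_of_mem_nhds hx hpre).trans_le (Measure.le_map_apply (by fun_prop) V)).ne'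

/-- The support is closed, stable under `x ↦ x / λ` and under `(x_i) ↦ (∑ x_i) / λ`, and contains
some `c > 0`. Hence it contains `0`, and by induction all `c j / λ^k` with `j ≤ p^k`. The mesh `c /
λ^k` tends to `0`, while the range `c (p / λ)^k` tends to infinity because `λ < 2 ≤ p`. -/
theorem support_eq (h : IsCycleLimitLaw p W) [IsProbabilityMeasure W] (hp : 1 < p) :
    W.support = Set.Ici 0 := by
  have hg := one_lt_cycleGrowth hp
  have hg0 := cycleGrowth_pos hp
  refine (Measure.support_subset_of_isClosed isClosed_Ici h.ae_nonneg).antisymm fun y hy => ?_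
  obtain ⟨c, hc, hcS⟩ := Measure.nonempty_inter_support_of_pos
    (show 0 < W (Set.Ioi 0) by rw [h.measure_Ioi hp]; exact one_pos)
  have hc0 : 0 < c := hc
  have hzero : (0 : ℝ) ∈ W.support := by
    have hmem : ∀ n : ℕ, ((cycleGrowth p)⁻¹) ^ n * c ∈ W.support := by
      intro n
      induction n with
      | zero => simpa
      | succ n ih => rw [pow_succ', mul_assoc]; exact h.inv_mul_mem_support hp ih
    have hlim := (tendsto_pow_atTop_nhds_zero_of_lt_one (inv_nonneg.2 hg0.le)
      (inv_lt_one_of_one_lt₀ hg)).mul_const c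
    rw [zero_mul] at hlim
    exact Measure.isClosed_support.mem_of_tendsto hlim (.of_forall hmem)
  have hgrid : ∀ (k j : ℕ), j ≤ p ^ k → c * (j / cycleGrowth p ^ k) ∈ W.support := by
    intro k
    induction k with
    | zero =>
      intro j hj
      rw [pow_zero] at hj
      interval_cases j
      · simpa
      · simpa
    | succ k ih =>
      intro j hj
      obtain ⟨a, ha, hs⟩ := exists_fin_sum_eq p (p ^ k) (j := j) (by rwa [← pow_succ'])
      have := h.inv_mul_sum_mem_support hp (x := fun l => c * (a l / cycleGrowth p ^ k))
        fun l => ih (a l) (ha l)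
      rw [← Finset.mul_sum, ← Finset.sum_div, ← Nat.cast_sum, hs] at this
      convert this using 1
      rw [pow_succ]
      field_simp
  have hp2 : (2 : ℝ) ≤ p := by exact_mod_cast hp
  have hpg : 1 < p / cycleGrowth p := (one_lt_div hg0).2 ((cycleGrowth_lt_two hp).trans_le hp2)
  have hyc : 0 ≤ y / c := div_nonneg hy hc0.le
  have hlim : Tendsto (fun k : ℕ => c * ((⌊y / c * cycleGrowth p ^ k⌋₊ : ℝ) / cycleGrowth p ^ k))
      atTop (𝓝 y) := by
    have := ((tendsto_nat_floor_mul_div_atTop hyc).comp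
      (tendsto_pow_atTop_atTop_of_one_lt hg)).const_mul c
    rwa [mul_div_cancel₀ y hc0.ne'] at this
  refine Measure.isClosed_support.mem_of_tendsto hlim ?_
  -- Once `(p / λ)^k ≥ y / c`, the floor is at most `p^k`, so the approximating point lies on the
  -- grid.
  filter_upwards [(tendsto_pow_atTop_atTop_of_one_lt hpg).eventually_ge_atTop (y / c)] with k hk
  refine hgrid k _ (Nat.floor_le_of_le ?_)
  rw [div_pow, le_div_iff₀ (by positivity)] at hk
  exact_mod_cast hk

end IsCycleLimitLaw

theorem mainTheorem1 (p : ℕ) (hp : p.Prime) :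
    -- the butterfly groups are Sylow `p`-subgroups
    (∀ n : ℕ, ∃ P : Sylow p (Equiv.Perm (Fin (p ^ n))),
      (P : Subgroup (Equiv.Perm (Fin (p ^ n)))) = butterflyGroup p n) ∧
    ∃ (m : ℕ → ℝ) (W : ProbabilityMeasure ℝ),
      -- the moment recursion
      (m 0 = 1 ∧ m 1 = 1 ∧ ∀ k : ℕ, 2 ≤ k →
        m k = 1 / ((p : ℝ) - 1) *
          (((2 - 1 / (p : ℝ)) - 1) / ((2 - 1 / (p : ℝ)) ^ k - (2 - 1 / (p : ℝ)))) *
          ∑ i ∈ (Finset.piAntidiag (Finset.univ : Finset (Fin p)) k).filter (fun i => ∀ l, i l < k),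
            (Nat.multinomial Finset.univ i : ℝ) * ∏ l, m (i l)) ∧
      -- the limit law lives on `(0, ∞)`, with full support there
      ((W : Measure ℝ) (Set.Ioi 0) = 1 ∧ (W : Measure ℝ).support = Set.Ici 0) ∧
      -- its moments, which determine it among the laws on `(0, ∞)`
      (∀ k : ℕ, Integrable (fun x : ℝ => x ^ k) (W : Measure ℝ) ∧
        ∫ x, x ^ k ∂(W : Measure ℝ) = m k) ∧
      (∀ V : ProbabilityMeasure ℝ, (V : Measure ℝ) (Set.Ioi 0) = 1 →
        (∀ k : ℕ, Integrable (fun x : ℝ => x ^ k) (V : Measure ℝ) ∧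
          ∫ x, x ^ k ∂(V : Measure ℝ) = m k) → V = W) ∧
      -- convergence in distribution for the butterfly groups
      Tendsto (fun n => scaledCycleLaw p n (butterflyGroup p n)) atTop (𝓝 W) ∧
      -- convergence in distribution for arbitrary Sylow `p`-subgroups
      (∀ P : (n : ℕ) → Sylow p (Equiv.Perm (Fin (p ^ n))),
        Tendsto (fun n => scaledCycleLaw p n (P n : Subgroup (Equiv.Perm (Fin (p ^ n)))))
          atTop (𝓝 W)) := by
  have : Fact p.Prime := ⟨hp⟩
  have hp1 := hp.one_lt
  obtain ⟨W, hW, hconv⟩ := exists_isCycleLimitLaw p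
  refine ⟨fun n => ⟨butterflySylow p n, coe_butterflySylow p n⟩,
    fun k => ∫ x, x ^ k ∂(W : Measure ℝ), W, ⟨by simp, by simpa using hW.integral_id hp1,
      fun k hk => hW.moment_recursion hp1 hk⟩, ⟨hW.measure_Ioi hp1, hW.support_eq hp1⟩,
    fun k => ⟨hW.integrable_pow k, rfl⟩, fun V hV hm => ?_, ?_, hconv⟩
  · have hVpos : ∀ᵐ x ∂(V : Measure ℝ), 0 < x := (mem_ae_iff_prob_eq_one measurableSet_Ioi).2 hV
    have key : (V : Measure ℝ) = W :=
      ext_of_moments hW.ae_nonneg (hVpos.mono fun _ hx => hx.le) hW.integrable_pow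
        (fun k => (hm k).1) hW.integrable_exp fun k => (hm k).2
    exact Subtype.ext key
  · simpa only [coe_butterflySylow] using hconv fun n => butterflySylow p n
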